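/- Let $k$ be an algebraically closed field of characteristic $p\ge 3$, let $r\ge 1$, let $\rho_1,\dots,\rho_r\in k$ be distinct, let $l_1,\dots,l_r\ge 1$ be integers prime to $p$, and let $f\in k[x]$ be a polynomial of degree $\sum_i l_i$ that is prime to $\prod_i(x-\rho_i)^{l_i}$ and satisfies $f(0)\neq 0$. Let $X$ be the smooth projective curve over $k$ whose function field is $k(x,y)$, where $x$ is transcendental over $k$ and $$y^p-y=\frac{f(x)}{\prod_{i=1}^r(x-\rho_i)^{l_i}} .$$ Let $U_0$ and $U_\infty$ be the complements in $X$ of the fibres of $x:X\to\mathbb{P}^1$ above $0$ and $\infty$, and describe $H^1_{dR}(X/k)$ by Čech cocycles for this covering: $$H^1_{dR}(X/k)=\frac{\{(\omega_0,\omega_\infty,h)\in\Omega_X(U_0)\times\Omega_X(U_\infty)\times\mathcal{O}_X(U_0\cap U_\infty)\ :\ dh=\omega_0-\omega_\infty\}}{\{(dh_0,dh_\infty,h_0-h_\infty)\ :\ h_0\in\mathcal{O}_X(U_0),\ h_\infty\in\mathcal{O}_X(U_\infty)\}} .$$ For $0\le\mu\le p-1$ put $$m_i^{(\mu)}=\Big\lfloor\frac{(p-1-\mu)l_i+(p-1)}{p}\Big\rfloor,\qquad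 t^{(\mu)}=\sum_{i=1}^r m_i^{(\mu)},\qquad g_\mu(x)=\prod_{i=1}^r(x-\rho_i)^{m_i^{(\mu)}},$$ and $\omega_{\mu,\nu}=x^{\nu-1}\frac{y^\mu}{g_\mu(x)}\,dx$ for $\nu\ge1$. Put $$\psi(x)=f(x)\sum_{i=1}^r l_i\prod_{j\ne i}(x-\rho_j)-f'(x)\prod_{i=1}^r(x-\rho_i).$$ For $1\le\mu\le p$ with $t^{(p-\mu)}\ge2$ (so that $\mu\ge2$, since $t^{(p-1)}=0$) and $1\le\nu\le t^{(p-\mu)}-1$ put $$\varphi_{\mu,\nu}(x)=x\,g_{p-\mu}'(x)g_{\mu-1}(x)-\nu\,g_{p-\mu}(x)g_{\mu-1}(x),$$ $$\omega_\mu=\frac{(\mu-1)\,g_{p-\mu}(x)\,y^{\mu-2}}{\prod_{i=1}^r(x-\rho_i)^{l_i+1}}\,dx,\qquad \tilde h_{\mu,\nu}=\frac{g_{p-\mu}(x)\,y^{\mu-1}}{x^\nu}.$$ For a polynomial $h$ let $h^{<n}$ and $h^{\ge n}$ denote the sums of its monomials of degree $<n$ and $\ge n$, respectively. Then the triples below are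 cocycles, and the classes $$a_{\mu,\nu}=\Big[\Big(\tfrac{\varphi_{\mu,\nu}^{<\nu+1}(x)}{x^{\nu+1}}\omega_{\mu-1,1}+\tfrac{\psi^{<\nu}(x)}{x^\nu}\omega_\mu,\ -\tfrac{\varphi_{\mu,\nu}^{\ge\nu+1}(x)}{x^{\nu+1}}\omega_{\mu-1,1}-\tfrac{\psi^{\ge\nu}(x)}{x^\nu}\omega_\mu,\ \tilde h_{\mu,\nu}\Big)\Big]$$ for $1\le\mu\le p$ with $t^{(p-\mu)}\ge2$ and $1\le\nu\le t^{(p-\mu)}-1$, together with the classes $$\delta_{\mu,\nu}=[(\omega_{\mu,\nu},\,\omega_{\mu,\nu},\,0)]$$ for $0\le\mu\le p-1$ with $t^{(\mu)}\ge2$ and $1\le\nu\le t^{(\mu)}-1$, form a basis of $H^1_{dR}(X/k)$ as a $k$-vector space. -/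

import Mathlib

open Polynomial
open scoped KaehlerDifferential

/-! ### The smooth projective curve of a function field, through its places

The closed points of the smooth projective curve `X` over the algebraically closed field `k` with
function field `F` are the valuation rings of `F` that contain `k` and are different from `F`. -/

/-- A closed point of `X`: a valuation ring of `F`, containing `k` and different from `F`;
the valuation ring is the local ring of `X` at the point. -/
structure CurvePoint (k F : Type*) [Field k] [Field F] [Algebra k F] where
  localRing : ValuationSubring F
  algebraMap_mem : ∀ c : k, algebraMap k F c ∈ localRing
  ne_top : localRing ≠ ⊤

namespace CurvePoint

variable {k F : Type*} [Field k] [Field F] [Algebra k F]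

/-- The stalk of `Ω_X` at the point `P`, inside the differentials `Ω[F⁄k]` of the function field:
the `𝒪_{X,P}`-submodule generated by the differentials of the elements of `𝒪_{X,P}`. -/
noncomputable def differentials (P : CurvePoint k F) : Submodule P.localRing.toSubring (Ω[F⁄k]) :=
  Submodule.span P.localRing.toSubring
    {ω | ∃ f : F, f ∈ P.localRing ∧ ω = KaehlerDifferential.D k F f}

end CurvePoint

section Curve

variable {k F : Type*} [Field k] [Field F] [Algebra k F]

/-- `𝒪_X(U)`: the rational functions that are regular at every point of `U`. -/
def regularFunctions (U : Set (CurvePoint k F)) : Submodule k F where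
  carrier := {f | ∀ P ∈ U, f ∈ P.localRing}
  add_mem' hf hg P hP := add_mem (hf P hP) (hg P hP)
  zero_mem' P _ := zero_mem P.localRing
  smul_mem' c f hf P hP := by
    rw [Algebra.smul_def]
    exact mul_mem (P.algebraMap_mem c) (hf P hP)

/-- `Ω_X(U)`: the rational differentials that are regular at every point of `U`. -/
def regularDifferentials (U : Set (CurvePoint k F)) : Submodule k (Ω[F⁄k]) where
  carrier := {ω | ∀ P ∈ U, ω ∈ P.differentials}
  add_mem' hf hg P hP := add_mem (hf P hP) (hg P hP)
  zero_mem' P _ := zero_mem P.differentials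
  smul_mem' c ω hω P hP := by
    have h := P.differentials.smul_mem (⟨algebraMap k F c, P.algebraMap_mem c⟩ :
      P.localRing.toSubring) (hω P hP)
    rw [← algebraMap_smul F c ω]
    exact h

/-- The points of `X` above `a ∈ k ⊆ ℙ¹`, for the map `X → ℙ¹` given by the rational function `x`:
the points at which `x - a` lies in the maximal ideal of the local ring. -/
def fibre (x : F) (a : k) : Set (CurvePoint k F) :=
  {P | x - algebraMap k F a ∈ P.localRing.nonunits}

/-- The points of `X` above `∞ ∈ ℙ¹`: the poles of `x`. -/
def fibreInfty (k : Type*) {F : Type*} [Field k] [Field F] [Algebra k F] (x : F) :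
    Set (CurvePoint k F) :=
  {P | x ∉ P.localRing}

/-- `U_0`, the complement in `X` of the fibre above `0`. -/
def openZero (k : Type*) {F : Type*} [Field k] [Field F] [Algebra k F] (x : F) :
    Set (CurvePoint k F) :=
  (fibre x (0 : k))ᶜ

/-- `U_∞`, the complement in `X` of the fibre above `∞`. -/
def openInfty (k : Type*) {F : Type*} [Field k] [Field F] [Algebra k F] (x : F) :
    Set (CurvePoint k F) :=
  (fibreInfty k x)ᶜ

/-- The Čech–de Rham 1-cocycles for the covering `X = U_0 ∪ U_∞`: triples `(ω_0, ω_∞, f)` in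
`Ω_X(U_0) × Ω_X(U_∞) × 𝒪_X(U_0 ∩ U_∞)` with `df = ω_0 - ω_∞`. -/
def deRhamCocycles (k : Type*) {F : Type*} [Field k] [Field F] [Algebra k F] (x : F) :
    Submodule k (Ω[F⁄k] × Ω[F⁄k] × F) where
  carrier := {c | c.1 ∈ regularDifferentials (openZero k x) ∧
    c.2.1 ∈ regularDifferentials (openInfty k x) ∧
    c.2.2 ∈ regularFunctions (openZero k x ∩ openInfty k x) ∧
    KaehlerDifferential.D k F c.2.2 = c.1 - c.2.1}
  add_mem' := by
    rintro a b ⟨h1, h2, h3, h4⟩ ⟨h1', h2', h3', h4'⟩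
    refine ⟨add_mem h1 h1', add_mem h2 h2', add_mem h3 h3', ?_⟩
    simp only [Prod.snd_add, Prod.fst_add, map_add, h4, h4']
    abel
  zero_mem' := ⟨zero_mem _, zero_mem _, zero_mem _, by simp⟩
  smul_mem' := by
    rintro c a ⟨h1, h2, h3, h4⟩
    refine ⟨Submodule.smul_mem _ c h1, Submodule.smul_mem _ c h2, Submodule.smul_mem _ c h3, ?_⟩
    simp only [Prod.smul_snd, Prod.smul_fst, Derivation.map_smul, h4, smul_sub]

/-- The Čech–de Rham 1-coboundaries: the triples `(df_0, df_∞, f_0 - f_∞)` with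
`f_0 ∈ 𝒪_X(U_0)` and `f_∞ ∈ 𝒪_X(U_∞)`. -/
def deRhamCoboundaries (k : Type*) {F : Type*} [Field k] [Field F] [Algebra k F] (x : F) :
    Submodule k (Ω[F⁄k] × Ω[F⁄k] × F) where
  carrier := {c | ∃ f₀ ∈ regularFunctions (openZero k x),
    ∃ f₁ ∈ regularFunctions (openInfty k x),
      c = (KaehlerDifferential.D k F f₀, KaehlerDifferential.D k F f₁, f₀ - f₁)}
  add_mem' := by
    rintro _ _ ⟨f, hf, g, hg, rfl⟩ ⟨f', hf', g', hg', rfl⟩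
    refine ⟨f + f', add_mem hf hf', g + g', add_mem hg hg', ?_⟩
    simp only [map_add, Prod.mk_add_mk]
    congr 2
    ring
  zero_mem' := ⟨0, zero_mem _, 0, zero_mem _, by simp only [map_zero, sub_zero]; rfl⟩
  smul_mem' := by
    rintro c _ ⟨f, hf, g, hg, rfl⟩
    refine ⟨c • f, Submodule.smul_mem _ c hf, c • g, Submodule.smul_mem _ c hg, ?_⟩
    simp only [Derivation.map_smul, Prod.smul_mk, smul_sub]

theorem deRhamCoboundaries_le (x : F) : deRhamCoboundaries k x ≤ deRhamCocycles k x := by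
  have key : ∀ (P : CurvePoint k F) (f : F), f ∈ P.localRing →
      KaehlerDifferential.D k F f ∈ P.differentials :=
    fun P f hf => Submodule.subset_span ⟨f, hf, rfl⟩
  rintro _ ⟨f, hf, g, hg, rfl⟩
  exact ⟨fun P hP => key P f (hf P hP), fun P hP => key P g (hg P hP),
    fun P hP => sub_mem (hf P hP.1) (hg P hP.2), by simp⟩

/-- `H¹_dR(X/k)`: Čech–de Rham cocycles modulo coboundaries. -/
abbrev DeRhamH1 (k : Type*) {F : Type*} [Field k] [Field F] [Algebra k F] (x : F) : Type _ :=
  deRhamCocycles k x ⧸ (deRhamCoboundaries k x).submoduleOf (deRhamCocycles k x)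

/-- The class of a cocycle in `H¹_dR(X/k)`. -/
noncomputable def deRhamClass (x : F) (c : Ω[F⁄k] × Ω[F⁄k] × F) (hc : c ∈ deRhamCocycles k x) :
    DeRhamH1 k x :=
  Submodule.Quotient.mk ⟨c, hc⟩

end Curve

/-! ### The explicit functions and differentials of an Artin–Schreier cover -/

namespace ArtinSchreier

noncomputable section

/-- `h^{< n}`: the sum of the monomials of `h` of degree `< n`. -/
def lowPart {k : Type*} [Field k] (n : ℕ) (h : k[X]) : k[X] :=
  ∑ i ∈ h.support with i < n, monomial i (h.coeff i)

/-- `h^{≥ n}`: the sum of the monomials of `h` of degree `≥ n`. -/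
def highPart {k : Type*} [Field k] (n : ℕ) (h : k[X]) : k[X] :=
  ∑ i ∈ h.support with n ≤ i, monomial i (h.coeff i)

/-- `m_i^{(μ)}` for `l_i = l`: the quotient of `(p - 1 - μ) l + (p - 1)` by `p`
(used for `0 ≤ μ ≤ p - 1` only). -/
def m (p μ l : ℕ) : ℕ := ((p - 1 - μ) * l + (p - 1)) / p

/-- `t^{(μ)} = ∑ i, m_i^{(μ)}`. -/
def t {r : ℕ} (p : ℕ) (l : Fin r → ℕ) (μ : ℕ) : ℕ := ∑ i, m p μ (l i)

variable {k F : Type*} [Field k] [Field F] [Algebra k F] {r : ℕ}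

/-- `g_μ(x) = ∏ i, (x - ρ_i) ^ m_i^{(μ)}`. -/
def g (p : ℕ) (ρ : Fin r → k) (l : Fin r → ℕ) (μ : ℕ) : k[X] :=
  ∏ i, (X - C (ρ i)) ^ m p μ (l i)

/-- `φ_{μ,ν} = x g_{p-μ}' g_{μ-1} - ν g_{p-μ} g_{μ-1}`. -/
def phi (p : ℕ) (ρ : Fin r → k) (l : Fin r → ℕ) (μ ν : ℕ) : k[X] :=
  X * derivative (g p ρ l (p - μ)) * g p ρ l (μ - 1)
    - C (ν : k) * g p ρ l (p - μ) * g p ρ l (μ - 1)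

/-- `ψ = f ∑ i, l_i ∏ j ≠ i, (x - ρ_j) - f' ∏ i, (x - ρ_i)`. -/
def psi (ρ : Fin r → k) (l : Fin r → ℕ) (f : k[X]) : k[X] :=
  f * ∑ i, C (l i : k) * ∏ j ∈ Finset.univ.erase i, (X - C (ρ j))
    - derivative f * ∏ i, (X - C (ρ i))

/-- `ω_{μ,ν} = x^{ν-1} (y^μ / g_μ(x)) dx`, for `ν ≥ 1`. -/
def omegaHol (p : ℕ) (ρ : Fin r → k) (l : Fin r → ℕ) (x y : F) (μ ν : ℕ) : Ω[F⁄k] :=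
  (x ^ (ν - 1) * (y ^ μ / aeval x (g p ρ l μ))) • KaehlerDifferential.D k F x

/-- `ω_μ = ((μ - 1) g_{p-μ}(x) y^{μ-2} / ∏ i, (x - ρ_i)^{l_i + 1}) dx`, for `μ ≥ 2`. -/
def omega (p : ℕ) (ρ : Fin r → k) (l : Fin r → ℕ) (x y : F) (μ : ℕ) : Ω[F⁄k] :=
  (((μ : F) - 1) * aeval x (g p ρ l (p - μ)) * y ^ (μ - 2)
    / ∏ i, (x - algebraMap k F (ρ i)) ^ (l i + 1)) • KaehlerDifferential.D k F x

/-- `h̃_{μ,ν} = g_{p-μ}(x) y^{μ-1} / x^ν`, for `μ ≥ 1`. -/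
def hTilde (p : ℕ) (ρ : Fin r → k) (l : Fin r → ℕ) (x y : F) (μ ν : ℕ) : F :=
  aeval x (g p ρ l (p - μ)) * y ^ (μ - 1) / x ^ ν

/-- The triple `(ω_{μ,ν}, ω_{μ,ν}, 0)` whose class is `δ_{μ,ν}`. -/
def deltaTriple (p : ℕ) (ρ : Fin r → k) (l : Fin r → ℕ) (x y : F) (μ ν : ℕ) :
    Ω[F⁄k] × Ω[F⁄k] × F :=
  (omegaHol p ρ l x y μ ν, omegaHol p ρ l x y μ ν, 0)

/-- The triple whose class is `a_{μ,ν}`: its components are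
`(φ_{μ,ν}^{<ν+1} / x^{ν+1}) ω_{μ-1,1} + (ψ^{<ν} / x^ν) ω_μ`,
`-((φ_{μ,ν}^{≥ν+1} / x^{ν+1}) ω_{μ-1,1} + (ψ^{≥ν} / x^ν) ω_μ)` and `h̃_{μ,ν}`.
The sign of the second one is the one for which `dh̃_{μ,ν} = ω_0 - ω_∞`. -/
def aTriple (p : ℕ) (ρ : Fin r → k) (l : Fin r → ℕ) (f : k[X]) (x y : F) (μ ν : ℕ) :
    Ω[F⁄k] × Ω[F⁄k] × F :=
  ((aeval x (lowPart (ν + 1) (phi p ρ l μ ν)) / x ^ (ν + 1)) • omegaHol p ρ l x y (μ - 1) 1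
      + (aeval x (lowPart ν (psi ρ l f)) / x ^ ν) • omega p ρ l x y μ,
    -((aeval x (highPart (ν + 1) (phi p ρ l μ ν)) / x ^ (ν + 1)) • omegaHol p ρ l x y (μ - 1) 1
      + (aeval x (highPart ν (psi ρ l f)) / x ^ ν) • omega p ρ l x y μ),
    hTilde p ρ l x y μ ν)

/-- The pairs `(μ, ν)` that index the classes `δ_{μ,ν}`:
`0 ≤ μ ≤ p - 1`, `t^{(μ)} ≥ 2` and `1 ≤ ν ≤ t^{(μ)} - 1`. -/
def DeltaIndex (p : ℕ) {r : ℕ} (l : Fin r → ℕ) : Type :=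
  {q : ℕ × ℕ // q.1 ≤ p - 1 ∧ 2 ≤ t p l q.1 ∧ 1 ≤ q.2 ∧ q.2 ≤ t p l q.1 - 1}

/-- The pairs `(μ, ν)` that index the classes `a_{μ,ν}`:
`1 ≤ μ ≤ p`, `t^{(p-μ)} ≥ 2` and `1 ≤ ν ≤ t^{(p-μ)} - 1`. As `t^{(p-1)} = 0`, they have `μ ≥ 2`. -/
def AIndex (p : ℕ) {r : ℕ} (l : Fin r → ℕ) : Type :=
  {q : ℕ × ℕ // 1 ≤ q.1 ∧ q.1 ≤ p ∧ 2 ≤ t p l (p - q.1) ∧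
    1 ≤ q.2 ∧ q.2 ≤ t p l (p - q.1) - 1}

end

end ArtinSchreier

/-!
Let `P` be a point above `ρ_i`. Since `l_i` is prime to `p`, the valuations at `P` of the terms of
`∑ μ < p, a_μ(x) y ^ μ` are pairwise distinct, so the sum is regular at `P` if and only if each term
is; where `y` is regular, the coefficients are regular together with the sum, by Lagrange
interpolation at the conjugates `y + j` of `y`, whose differences are units. So the regularity of
functions and differentials on `U_0` and `U_∞` can be read off from Laurent expansions in `x` of
the coefficients `a_μ`: `𝒪(U_0 ∩ U_∞)` has the basis `x ^ j g_{p-1-μ}(x) y ^ μ`, with `j ≥ 0` for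
`𝒪(U_∞)` and `j ≤ -t^{(p-1-μ)}` for `𝒪(U_0)`, and the `ω_{μ,ν}` are a basis of `H⁰(X, Ω)`. The
basis functions with `-t^{(p-1-μ)} < j < 0` are exactly the `h̃_{μ,ν}`, which thus give a basis of
`H¹(X, 𝒪)`. One concludes by the exact sequence `0 → H⁰(X, Ω) → H¹_dR(X/k) → H¹(X, 𝒪)`, since the
`a_{μ,ν}` lift the `h̃_{μ,ν}` to de Rham classes.
-/

theorem valuation_le_valuation_sum_of_pairwise_ne {R Γ ι : Type*} [Ring R]
    [LinearOrderedCommGroupWithZero Γ] (v : Valuation R Γ) {s : Finset ι} {a : ι → R}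
    (h : ∀ i ∈ s, ∀ j ∈ s, i ≠ j → v (a i) ≠ 0 → v (a j) ≠ 0 → v (a i) ≠ v (a j))
    {i : ι} (hi : i ∈ s) : v (a i) ≤ v (∑ j ∈ s, a j) := by
  classical
  obtain ⟨m, hm, hmax⟩ := s.exists_max_image (fun j => v (a j)) ⟨i, hi⟩
  rcases eq_or_ne (v (a m)) 0 with hm0 | hm0
  · exact (hmax i hi).trans (hm0.trans_le zero_le)
  · refine (hmax i hi).trans_eq (v.map_sum_eq_of_lt hm fun j hj => ?_).symm
    obtain ⟨hjs, hjm⟩ := Finset.mem_sdiff.1 hj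
    refine (hmax j hjs).lt_of_ne fun e => ?_
    exact h j hjs m hm (by simpa using hjm) (e ▸ hm0) hm0 e

namespace CurvePoint

variable {k F : Type*} [Field k] [Field F] [Algebra k F]

/-- The valuation of the function field at a point, written multiplicatively: functions vanishing
at the point have value `< 1`, functions with a pole there have value `> 1`. -/
noncomputable abbrev val (P : CurvePoint k F) : Valuation F P.localRing.ValueGroup :=
  P.localRing.valuation

variable (P : CurvePoint k F) {u y : F} {c : k} {q : k[X]}

theorem val_le_one_iff {a : F} : P.val a ≤ 1 ↔ a ∈ P.localRing :=
  P.localRing.valuation_le_one_iff a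

instance isTrivialOn_val : P.val.IsTrivialOn k where
  eq_one c hc := by
    refine le_antisymm (P.val_le_one_iff.2 (P.algebraMap_mem c)) ?_
    rw [← inv_le_one₀ (by simpa [zero_lt_iff] using hc), ← map_inv₀, ← map_inv₀]
    exact P.val_le_one_iff.2 (P.algebraMap_mem c⁻¹)

theorem val_algebraMap_le (c : k) : P.val (algebraMap k F c) ≤ 1 :=
  P.val_le_one_iff.2 (P.algebraMap_mem c)

theorem val_algebraMap (hc : c ≠ 0) : P.val (algebraMap k F c) = 1 :=
  Valuation.IsTrivialOn.eq_one c hc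

theorem val_ne_zero {a : F} (ha : a ≠ 0) : P.val a ≠ 0 :=
  P.val.ne_zero_iff.2 ha

theorem val_pos {a : F} (ha : a ≠ 0) : 0 < P.val a :=
  zero_lt_iff.2 (P.val_ne_zero ha)

theorem aeval_mem_localRing (hu : u ∈ P.localRing) (q : k[X]) : aeval u q ∈ P.localRing := by
  rw [aeval_eq_sum_range]
  refine sum_mem fun i _ => ?_
  rw [Algebra.smul_def]
  exact mul_mem (P.algebraMap_mem _) (pow_mem hu i)

theorem val_aeval_le (hu : P.val u ≤ 1) (q : k[X]) : P.val (aeval u q) ≤ 1 :=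
  P.val_le_one_iff.2 (P.aeval_mem_localRing (P.val_le_one_iff.1 hu) q)

theorem val_aeval_le_pow (hu : 1 < P.val u) {n : ℕ} (hq : q.natDegree ≤ n) :
    P.val (aeval u q) ≤ P.val u ^ n := by
  rcases eq_or_ne q 0 with rfl | hq0
  · simp
  · rw [valuation_aeval_eq_valuation_X_pow_natDegree_of_one_lt_valuation_X u hu hq0]
    exact pow_le_pow_right₀ hu.le hq

theorem val_le_one_of_val_sub_lt (h : P.val (u - algebraMap k F c) < 1) : P.val u ≤ 1 := by
  simpa using P.val.map_add_le h.le (P.val_algebraMap_le c)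

theorem val_aeval_eq_one (h : P.val (u - algebraMap k F c) < 1) (hq : q.eval c ≠ 0) :
    P.val (aeval u q) = 1 := by
  obtain ⟨w, hw⟩ := X_sub_C_dvd_sub_C_eval (p := q) (a := c)
  have taylor : aeval u q =
      (u - algebraMap k F c) * aeval u w + algebraMap k F (q.eval c) := by
    simpa using congrArg (aeval u) (sub_eq_iff_eq_add.1 hw)
  rw [taylor, P.val.map_add_eq_of_lt_right, P.val_algebraMap hq]
  rw [P.val_algebraMap hq, map_mul]
  exact mul_lt_one_of_lt_of_le h (P.val_aeval_le (P.val_le_one_of_val_sub_lt h) w)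

theorem val_aeval_eq_pow (h : P.val (u - algebraMap k F c) < 1) (hq : q ≠ 0) :
    P.val (aeval u q) = P.val (u - algebraMap k F c) ^ q.rootMultiplicity c := by
  obtain ⟨w, hw, hd⟩ := exists_eq_pow_rootMultiplicity_mul_and_not_dvd q hq c
  rw [dvd_iff_isRoot] at hd
  conv_lhs => rw [hw]
  simp only [map_mul, map_pow, map_sub, aeval_X, aeval_C, P.val_aeval_eq_one h hd, mul_one]

theorem exists_val_eq_zpow (hu : u - algebraMap k F c ≠ 0)
    (h : P.val (u - algebraMap k F c) < 1) {a : F}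
    (ha : a ∈ IntermediateField.adjoin k {u}) (ha0 : a ≠ 0) :
    ∃ e : ℤ, P.val a = P.val (u - algebraMap k F c) ^ e := by
  obtain ⟨n, d, rfl⟩ := (IntermediateField.mem_adjoin_simple_iff k a).1 ha
  have hn : n ≠ 0 := by rintro rfl; simp at ha0
  have hd : d ≠ 0 := by rintro rfl; simp at ha0
  refine ⟨(n.rootMultiplicity c : ℤ) - d.rootMultiplicity c, ?_⟩
  rw [map_div₀, P.val_aeval_eq_pow h hn, P.val_aeval_eq_pow h hd,
    zpow_sub₀ (P.val_ne_zero hu), zpow_natCast, zpow_natCast]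

theorem exists_eq_div_of_val_le_one (hu : u - algebraMap k F c ≠ 0)
    (h : P.val (u - algebraMap k F c) < 1) {a : F}
    (ha : a ∈ IntermediateField.adjoin k {u}) (ha1 : P.val a ≤ 1) :
    ∃ n d : k[X], d.eval c ≠ 0 ∧ a = aeval u n / aeval u d := by
  rcases eq_or_ne a 0 with rfl | ha0
  · exact ⟨0, 1, by simp, by simp⟩
  obtain ⟨n, d, rfl⟩ := (IntermediateField.mem_adjoin_simple_iff k a).1 ha
  have hn : n ≠ 0 := by rintro rfl; simp at ha0
  have hd : d ≠ 0 := by rintro rfl; simp at ha0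
  have hle : d.rootMultiplicity c ≤ n.rootMultiplicity c := by
    rw [map_div₀, P.val_aeval_eq_pow h hn, P.val_aeval_eq_pow h hd,
      div_le_one₀ (pow_pos (P.val_pos hu) _)] at ha1
    exact (pow_le_pow_iff_right_of_lt_one₀ (P.val_pos hu) h).1 ha1
  obtain ⟨n', hn'⟩ := (le_rootMultiplicity_iff hn).1 hle
  obtain ⟨d', hd', hdvd⟩ := exists_eq_pow_rootMultiplicity_mul_and_not_dvd d hd c
  refine ⟨n', d', by rwa [dvd_iff_isRoot] at hdvd, ?_⟩
  rw [congrArg (aeval u) hn', congrArg (aeval u) hd', map_mul, map_mul, mul_div_mul_left]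
  simpa only [map_pow, map_sub, aeval_X, aeval_C] using pow_ne_zero _ hu

theorem exists_isRoot_of_val_aeval_lt [IsAlgClosed k] (hy : P.val y ≤ 1) (hq : q ≠ 0)
    (h : P.val (aeval y q) < 1) : ∃ β, q.IsRoot β ∧ P.val (y - algebraMap k F β) < 1 := by
  by_contra! h0
  have h1 {β : k} (hβ : β ∈ q.roots) : P.val (y - algebraMap k F β) = 1 :=
    (h0 β (isRoot_of_mem_roots hβ)).antisymm'
      (P.val_le_one_iff.2 (sub_mem (P.val_le_one_iff.1 hy) (P.algebraMap_mem β)))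
  rw [(IsAlgClosed.splits q).eq_prod_roots, map_mul, map_mul, aeval_C,
    P.val_algebraMap (leadingCoeff_ne_zero.2 hq), one_mul, map_multiset_prod,
    map_multiset_prod, Multiset.map_map, Multiset.map_map] at h
  refine h.ne (Multiset.prod_eq_one fun a ha => ?_)
  obtain ⟨β, hβ, rfl⟩ := Multiset.mem_map.1 ha
  simpa using h1 hβ

theorem exists_val_lt_one (hu : Transcendental k u) : ∃ P : CurvePoint k F, P.val u < 1 := by
  let A : Subring F := (aeval u : k[X] →ₐ[k] F).range.toSubring
  have hmem (q : k[X]) : aeval u q ∈ A := ⟨q, rfl⟩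
  have huA : u ∈ A := by simpa using hmem X
  have hI : Ideal.span {(⟨u, huA⟩ : A)} ≠ ⊤ := by
    intro h
    rw [Ideal.span_singleton_eq_top, isUnit_iff_exists_inv] at h
    obtain ⟨⟨_, q, rfl⟩, hq⟩ := h
    have hq' : u * aeval u q = 1 := congrArg Subtype.val hq
    refine hu ⟨X * q - 1, fun h0 => ?_, by simp [hq']⟩
    simpa using congrArg (eval 0) h0
  obtain ⟨B, hAB, hB⟩ := Ideal.image_subset_nonunits_valuationSubring _ hI
  have huB : u ∈ B.nonunits := hB ⟨_, Ideal.subset_span rfl, rfl⟩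
  refine ⟨⟨B, fun c => hAB (by simpa using hmem (C c)), ?_⟩, huB⟩
  rintro rfl
  rw [ValuationSubring.mem_nonunits_iff_or] at huB
  rcases huB with rfl | h
  · exact hu isAlgebraic_zero
  · exact h (ValuationSubring.mem_top _)

end CurvePoint

namespace ArtinSchreier

variable {k F : Type*} [Field k] [Field F] [Algebra k F] {p : ℕ} {K : IntermediateField k F} {y : F}

/-- `F = K(y)` is an extension of degree `p` of the intermediate field `K`, generated by a root `y`
of an Artin–Schreier equation `y ^ p - y = a` with `a ∈ K`. -/
structure IsGenerator (p : ℕ) (K : IntermediateField k F) (y : F) : Prop where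
  prime : p.Prime
  pow_sub_mem : y ^ p - y ∈ K
  adjoin_eq_top : IntermediateField.adjoin K {y} = ⊤
  natDegree_minpoly : (minpoly K y).natDegree = p

theorem monic_X_pow_sub_X_sub_C {R : Type*} [Ring R] [Nontrivial R] (hp : 1 < p) (a : R) :
    (X ^ p - X - C a).Monic := by
  rw [sub_sub]
  exact monic_X_pow_sub (by rw [degree_X_add_C]; exact_mod_cast hp)

theorem natDegree_X_pow_sub_X_sub_C {R : Type*} [Ring R] [Nontrivial R] (hp : 1 < p) (a : R) :
    (X ^ p - X - C a).natDegree = p := by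
  rw [sub_sub, natDegree_sub_eq_left_of_natDegree_lt] <;> simp [hp]

namespace IsGenerator

theorem isIntegral (h : IsGenerator p K y) : IsIntegral K y :=
  minpoly.ne_zero_iff.1 fun h0 => h.prime.ne_zero <| by
    rw [← h.natDegree_minpoly, h0, natDegree_zero]

theorem minpoly_eq (h : IsGenerator p K y) :
    minpoly K y = X ^ p - X - C ⟨y ^ p - y, h.pow_sub_mem⟩ := by
  refine (eq_of_monic_of_dvd_of_natDegree_le (minpoly.monic h.isIntegral)
    (monic_X_pow_sub_X_sub_C h.prime.one_lt _) (minpoly.dvd _ _ (by simp)) ?_).symm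
  rw [natDegree_X_pow_sub_X_sub_C h.prime.one_lt, h.natDegree_minpoly]

theorem exists_eq_sum (h : IsGenerator p K y) (z : F) :
    ∃ a : ℕ → F, (∀ μ, a μ ∈ K) ∧ z = ∑ μ ∈ Finset.range p, a μ * y ^ μ := by
  have hz : z ∈ (IntermediateField.adjoin K {y}).toSubalgebra := by
    rw [h.adjoin_eq_top]; trivial
  rw [IntermediateField.adjoin_simple_toSubalgebra_of_isAlgebraic h.isIntegral.isAlgebraic,
    Algebra.adjoin_singleton_eq_range_aeval] at hz
  obtain ⟨s, rfl⟩ := hz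
  have hdeg : (s %ₘ minpoly K y).natDegree < p := h.natDegree_minpoly ▸
    natDegree_modByMonic_lt s (minpoly.monic h.isIntegral) (minpoly.ne_one K y)
  refine ⟨fun μ => ((s %ₘ minpoly K y).coeff μ : F), fun μ => SetLike.coe_mem _, ?_⟩
  change aeval y s = _
  rw [← aeval_modByMonic_eq_self_of_root (minpoly.aeval K y), aeval_eq_sum_range' hdeg]
  rfl

theorem linearIndependent_pow (h : IsGenerator p K y) :
    LinearIndependent K fun μ : Fin p => y ^ (μ : ℕ) := by
  have hy := _root_.linearIndependent_pow (K := K) y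
  rwa [h.natDegree_minpoly] at hy

theorem linearIndependent_mul_pow (h : IsGenerator p K y) {a : Fin p → F} (ha : ∀ μ, a μ ∈ K)
    (ha0 : ∀ μ, a μ ≠ 0) : LinearIndependent K fun μ : Fin p => a μ * y ^ (μ : ℕ) :=
  h.linearIndependent_pow.units_smul fun μ =>
    Units.mk0 (⟨a μ, ha μ⟩ : K) fun h0 => ha0 μ (congrArg Subtype.val h0)

theorem exists_algHom [CharP k p] (h : IsGenerator p K y) (j : ℕ) :
    ∃ σ : F →ₐ[K] F, σ y = y + j := by
  have := Fact.mk h.prime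
  have : CharP F p := (Algebra.charP_iff k F p).1 inferInstance
  let pb := (IntermediateField.adjoin.powerBasis h.isIntegral).map
    ((IntermediateField.equivOfEq h.adjoin_eq_top).trans IntermediateField.topEquiv)
  have hgen : pb.gen = y := by simp [pb]
  have hroot : aeval (y + (j : F)) (minpoly K pb.gen) = 0 := by
    have hj : (j : F) ^ p = j := by rw [← frobenius_def, map_natCast]
    rw [hgen, h.minpoly_eq]
    simp only [map_sub, map_pow, aeval_X, aeval_C, add_pow_char, hj]
    change y ^ p + j - (y + j) - (y ^ p - y) = 0
    ring
  exact ⟨pb.lift (y + j) hroot, (congrArg _ hgen.symm).trans (pb.lift_gen _ _)⟩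

theorem isSeparable [CharP k p] (h : IsGenerator p K y) : Algebra.IsSeparable K F := by
  have hy : IsSeparable K y := by
    have : CharP K p := (Algebra.charP_iff k _ p).1 inferInstance
    rw [IsSeparable, h.minpoly_eq, separable_def]
    exact ⟨0, -1, by simp [derivative_X_pow, CharP.cast_eq_zero]⟩
  have := (IntermediateField.isSeparable_adjoin_simple_iff_isSeparable _ _).2 hy
  exact AlgEquiv.Algebra.isSeparable
    ((IntermediateField.equivOfEq h.adjoin_eq_top).trans IntermediateField.topEquiv)

end IsGenerator

end ArtinSchreier

namespace CurvePoint

variable {k F : Type*} [Field k] [Field F] [Algebra k F] {p : ℕ} (P : CurvePoint k F) {y : F}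

theorem mem_of_pow_sub_mem (hp : 1 < p) (h : y ^ p - y ∈ P.localRing) : y ∈ P.localRing := by
  rw [← P.val_le_one_iff] at h ⊢
  by_contra! hy
  rw [P.val.map_sub_eq_of_lt_left, map_pow] at h
  · exact h.not_gt (one_lt_pow₀ hy (by omega))
  · rw [map_pow]
    exact lt_self_pow₀ hy hp

theorem mem_lifts_of_eval_natCast_mem [CharP k p] {q : F[X]} (hq : q.natDegree < p)
    (h : ∀ j < p, q.eval (j : F) ∈ P.localRing) : q ∈ lifts P.localRing.subtype := by
  have : CharP F p := (Algebra.charP_iff k F p).1 inferInstance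
  have hC {z : F} (hz : z ∈ P.localRing) : C z ∈ lifts P.localRing.subtype :=
    C'_mem_lifts ⟨⟨z, hz⟩, rfl⟩
  have hlin (i : ℕ) : X - C (i : F) ∈ lifts P.localRing.subtype := by
    rw [sub_eq_add_neg, ← C_neg]
    exact add_mem (X_mem_lifts _) (hC (neg_mem (natCast_mem _ i)))
  have hinj : Set.InjOn (fun j : ℕ => (j : F)) (Finset.range p) := by
    intro i hi j hj e
    simp only [Finset.coe_range, Set.mem_Iio] at hi hj
    exact Nat.ModEq.eq_of_lt_of_lt ((CharP.natCast_eq_natCast F p).1 e) hi hj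
  have hdeg : q.degree < (Finset.range p).card := by
    rw [Finset.card_range]
    exact degree_le_natDegree.trans_lt (by exact_mod_cast hq)
  rw [Lagrange.eq_interpolate hinj hdeg, Lagrange.interpolate_apply]
  refine sum_mem fun j hj => mul_mem (hC (h j (Finset.mem_range.1 hj)))
    (prod_mem fun i _ => mul_mem (hC ?_) (hlin i))
  simpa using P.algebraMap_mem ((j : k) - i)⁻¹

/-- Lagrange interpolation at the translates of `y` by the prime field, whose differences are
units of `k`. -/
theorem coeff_mem_of_sum_mem [CharP k p] (hy : y ∈ P.localRing) {a : ℕ → F}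
    (h : ∀ j < p, ∑ μ ∈ Finset.range p, a μ * (y + (j : F)) ^ μ ∈ P.localRing) {μ : ℕ}
    (hμ : μ < p) : a μ ∈ P.localRing := by
  let q : F[X] := ∑ μ ∈ Finset.range p, monomial μ (a μ)
  have hdeg : q.natDegree < p :=
    (natDegree_sum_le_of_forall_le (n := p - 1) _ _ fun ν hν =>
      (natDegree_monomial_le _).trans (Nat.le_sub_one_of_lt (Finset.mem_range.1 hν))).trans_lt
      (by omega)
  obtain ⟨w, hw⟩ : q.comp (X + C y) ∈ lifts P.localRing.subtype := by
    refine P.mem_lifts_of_eval_natCast_mem (p := p) ?_ fun j hj => ?_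
    · rwa [natDegree_comp, natDegree_X_add_C, mul_one]
    · simpa [q, eval_comp, eval_finsetSum, add_comm] using h j hj
  have hq : q = (w.comp (X - C ⟨y, hy⟩)).map P.localRing.subtype := by
    rw [Polynomial.map_comp, show w.map _ = _ from hw, comp_assoc]
    simp
  have hcoeff : a μ = q.coeff μ := by simp [q, coeff_monomial, hμ]
  rw [hcoeff, hq, coeff_map]
  exact SetLike.coe_mem _

end CurvePoint

namespace ArtinSchreier.IsGenerator

variable {k F : Type*} [Field k] [Field F] [Algebra k F] {p : ℕ} {K : IntermediateField k F} {y : F}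

theorem exists_mem_notMem (h : IsGenerator p K y) (P : CurvePoint k F) :
    ∃ a ∈ K, a ∉ P.localRing := by
  by_contra! hK
  refine P.ne_top (eq_top_iff.2 fun z _ => ?_)
  obtain ⟨a, ha, rfl⟩ := h.exists_eq_sum z
  have hy := P.mem_of_pow_sub_mem h.prime.one_lt (hK _ h.pow_sub_mem)
  exact sum_mem fun μ _ => mul_mem (hK _ (ha μ)) (pow_mem hy μ)

theorem exists_conj [CharP k p] (h : IsGenerator p K y) (P : CurvePoint k F) (j : ℕ) :
    ∃ (σ : F →ₐ[K] F) (P' : CurvePoint k F), σ y = y + j ∧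
      ∀ z, z ∈ P'.localRing ↔ σ z ∈ P.localRing := by
  obtain ⟨σ, hσ⟩ := h.exists_algHom j
  have hfix (a : F) (ha : a ∈ K) : (σ : F →+* F) a = a := σ.commutes ⟨a, ha⟩
  obtain ⟨a, ha, haP⟩ := h.exists_mem_notMem P
  refine ⟨σ, ⟨P.localRing.comap (σ : F →+* F), fun c => ?_, fun htop => haP ?_⟩, hσ,
    fun z => Iff.rfl⟩
  · rw [ValuationSubring.mem_comap, hfix _ (K.algebraMap_mem c)]
    exact P.algebraMap_mem c
  · have hmem : a ∈ P.localRing.comap (σ : F →+* F) := htop ▸ ValuationSubring.mem_top a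
    rwa [ValuationSubring.mem_comap, hfix a ha] at hmem

theorem coeff_mem [CharP k p] (h : IsGenerator p K y) (P : CurvePoint k F)
    (hy : y ∈ P.localRing) {a : ℕ → F} (ha : ∀ μ, a μ ∈ K)
    (hreg : ∀ P' : CurvePoint k F, (∀ z ∈ K, z ∈ P'.localRing ↔ z ∈ P.localRing) →
      ∑ μ ∈ Finset.range p, a μ * y ^ μ ∈ P'.localRing) {μ : ℕ} (hμ : μ < p) :
    a μ ∈ P.localRing := by
  refine P.coeff_mem_of_sum_mem (p := p) hy (fun j _ => ?_) hμ
  obtain ⟨σ, P', hσ, hP'⟩ := h.exists_conj P j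
  have hfix (z : F) (hz : z ∈ K) : σ z = z := σ.commutes ⟨z, hz⟩
  have hmem := (hP' _).1 (hreg P' fun z hz => by rw [hP', hfix z hz])
  simpa only [map_sum, map_mul, map_pow, hσ, hfix _ (ha _)] using hmem

end ArtinSchreier.IsGenerator

section KaehlerDifferential

variable {k F : Type*} [Field k] [Field F] [Algebra k F] {x : F}

theorem aeval_ne_zero_of_transcendental (hx : Transcendental k x) {q : k[X]} (hq : q ≠ 0) :
    aeval x q ≠ 0 :=
  fun h => hx ⟨q, hq, h⟩

theorem exists_kaehlerEquiv_D_eq_one (hx : Transcendental k x)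
    [Algebra.IsSeparable (IntermediateField.adjoin k {x}) F] :
    ∃ e : Ω[F⁄k] ≃ₗ[F] F, e (KaehlerDifferential.D k F x) = 1 := by
  let K := IntermediateField.adjoin k {x}
  let x' : K := IntermediateField.AdjoinSimple.gen k x
  let : Algebra k[X] K := (aeval x').toAlgebra
  let : Algebra k[X] F := (aeval x).toAlgebra
  have hcoe (q : k[X]) : ((aeval x' q : K) : F) = aeval x q := (aeval_algebraMap_apply F x' q).symm
  have : IsScalarTower k k[X] F := IsScalarTower.of_algebraMap_eq fun c => (aeval_C x c).symm
  have : IsScalarTower k[X] K F := IsScalarTower.of_algebraMap_eq fun q => (hcoe q).symm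
  have hinj : Function.Injective (algebraMap k[X] K) := by
    refine (injective_iff_map_eq_zero _).2 fun q hq => ?_
    by_contra h0
    exact aeval_ne_zero_of_transcendental hx h0 ((hcoe q).symm.trans (congrArg Subtype.val hq))
  have : FaithfulSMul k[X] K := (faithfulSMul_iff_algebraMap_injective _ _).2 hinj
  have : IsFractionRing k[X] K := IsFractionRing.of_field _ _ fun z => by
    obtain ⟨n, d, hz⟩ := (IntermediateField.mem_adjoin_simple_iff k z.1).1 z.2
    exact ⟨n, d, Subtype.ext (hz.trans (by rw [← hcoe, ← hcoe]; rfl))⟩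
  have : Algebra.FormallyEtale k[X] K :=
    Algebra.FormallyEtale.of_isLocalization (nonZeroDivisors k[X])
  have : Algebra.FormallyEtale K F := Algebra.FormallyEtale.of_isSeparable K F
  have : Algebra.FormallyEtale k[X] F := Algebra.FormallyEtale.comp k[X] K F
  refine ⟨(KaehlerDifferential.tensorKaehlerEquivOfFormallyEtale k k[X] F).symm.trans
    ((TensorProduct.AlgebraTensorModule.congr (LinearEquiv.refl F F)
      (KaehlerDifferential.polynomialEquiv k)).trans
      (TensorProduct.AlgebraTensorModule.rid k[X] F F)), ?_⟩
  have hD := KaehlerDifferential.tensorKaehlerEquivOfFormallyEtale_symm_D_algebraMap k k[X] F X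
  rw [show algebraMap k[X] F X = x from aeval_X x] at hD
  simp [hD]

theorem D_ne_zero_of_transcendental (hx : Transcendental k x)
    [Algebra.IsSeparable (IntermediateField.adjoin k {x}) F] :
    KaehlerDifferential.D k F x ≠ 0 := by
  obtain ⟨e, he⟩ := exists_kaehlerEquiv_D_eq_one hx
  intro h
  simp [h] at he

theorem exists_eq_smul_D_of_transcendental (hx : Transcendental k x)
    [Algebra.IsSeparable (IntermediateField.adjoin k {x}) F] (ω : Ω[F⁄k]) :
    ∃ a : F, ω = a • KaehlerDifferential.D k F x := by
  obtain ⟨e, he⟩ := exists_kaehlerEquiv_D_eq_one hx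
  exact ⟨e ω, e.injective (by simp [he])⟩

theorem D_pow_sub_self (p : ℕ) [CharP k p] (y : F) :
    KaehlerDifferential.D k F (y ^ p - y) = -KaehlerDifferential.D k F y := by
  have : CharP F p := (Algebra.charP_iff k F p).1 inferInstance
  rw [map_sub, Derivation.leibniz_pow, ← Nat.cast_smul_eq_nsmul F, CharP.cast_eq_zero, zero_smul,
    zero_sub]

end KaehlerDifferential

namespace CurvePoint

variable {k F : Type*} [Field k] [Field F] [Algebra k F] {P : CurvePoint k F} {u : F} {c : k}

/-- The functions regular at `P` whose differential is a regular multiple of `du`. Everything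
regular at `P` is of this kind if `u - c` is a uniformizer for some `c ∈ k`. -/
def regularDeriv (P : CurvePoint k F) (u : F) : Subalgebra k F where
  carrier := {a | a ∈ P.localRing ∧
    ∃ a' ∈ P.localRing, KaehlerDifferential.D k F a = a' • KaehlerDifferential.D k F u}
  mul_mem' := by
    rintro a b ⟨ha, a', ha', ea⟩ ⟨hb, b', hb', eb⟩
    refine ⟨mul_mem ha hb, a * b' + b * a', add_mem (mul_mem ha hb') (mul_mem hb ha'), ?_⟩
    rw [Derivation.leibniz, ea, eb, smul_smul, smul_smul, add_smul]
  add_mem' := by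
    rintro a b ⟨ha, a', ha', ea⟩ ⟨hb, b', hb', eb⟩
    exact ⟨add_mem ha hb, a' + b', add_mem ha' hb', by rw [map_add, ea, eb, add_smul]⟩
  algebraMap_mem' c := ⟨P.algebraMap_mem c, 0, zero_mem _, by simp⟩

theorem inv_mem_regularDeriv {a : F} (ha : a ∈ P.regularDeriv u) (h : P.val a = 1) :
    a⁻¹ ∈ P.regularDeriv u := by
  obtain ⟨-, a', ha', e⟩ := ha
  have hi : a⁻¹ ∈ P.localRing := P.val_le_one_iff.1 (by rw [map_inv₀, h, inv_one])
  refine ⟨hi, -(a⁻¹ ^ 2) * a', mul_mem (neg_mem (pow_mem hi 2)) ha', ?_⟩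
  rw [Derivation.leibniz_inv, e, smul_smul]

theorem aeval_mem_regularDeriv (hu : u ∈ P.localRing) (q : k[X]) :
    aeval u q ∈ P.regularDeriv u :=
  ⟨P.aeval_mem_localRing hu q, _, P.aeval_mem_localRing hu (derivative q),
    Derivation.map_aeval _ _ _⟩

theorem mem_regularDeriv_of_pow_sub_mem {p : ℕ} [CharP k p] {y : F} (hy : y ∈ P.localRing)
    (h : y ^ p - y ∈ P.regularDeriv u) : y ∈ P.regularDeriv u := by
  obtain ⟨-, a, ha, e⟩ := h
  exact ⟨hy, -a, neg_mem ha, by rw [neg_smul, ← e, D_pow_sub_self, neg_neg]⟩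

theorem mem_regularDeriv_of_mem_adjoin (hu : u - algebraMap k F c ≠ 0)
    (h : P.val (u - algebraMap k F c) < 1) {a : F}
    (ha : a ∈ IntermediateField.adjoin k {u}) (ha1 : P.val a ≤ 1) : a ∈ P.regularDeriv u := by
  obtain ⟨n, d, hd, rfl⟩ := P.exists_eq_div_of_val_le_one hu h ha ha1
  have hu1 := P.val_le_one_iff.1 (P.val_le_one_of_val_sub_lt h)
  rw [div_eq_mul_inv]
  exact mul_mem (aeval_mem_regularDeriv hu1 n)
    (inv_mem_regularDeriv (aeval_mem_regularDeriv hu1 d) (P.val_aeval_eq_one h hd))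

theorem exists_val_sub_le_of_mem_adjoin (hu : u - algebraMap k F c ≠ 0)
    (h : P.val (u - algebraMap k F c) < 1) {a : F}
    (ha : a ∈ IntermediateField.adjoin k {u}) (ha1 : P.val a ≤ 1) :
    ∃ b : k, P.val (a - algebraMap k F b) ≤ P.val (u - algebraMap k F c) := by
  obtain ⟨n, d, hd, rfl⟩ := P.exists_eq_div_of_val_le_one hu h ha ha1
  have hd1 := P.val_aeval_eq_one h hd
  have hd0 : aeval u d ≠ 0 := by rintro h0; simp [h0] at hd1
  obtain ⟨w, hw⟩ : X - C c ∣ n - C (n.eval c / d.eval c) * d := by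
    rw [dvd_iff_isRoot]
    simp [hd]
  refine ⟨n.eval c / d.eval c, ?_⟩
  have taylor := congrArg (aeval u) hw
  simp only [map_sub, map_mul, aeval_C, aeval_X] at taylor
  rw [div_sub' hd0, map_div₀, hd1, div_one, mul_comm, taylor, map_mul]
  exact mul_le_of_le_one_right' (P.val_aeval_le (P.val_le_one_of_val_sub_lt h) w)

theorem exists_forall_val_pow_mul_le_one (hu : u - algebraMap k F c ≠ 0)
    (h : P.val (u - algebraMap k F c) < 1) {a : ℕ → F}
    (ha : ∀ μ, a μ ∈ IntermediateField.adjoin k {u}) (n : ℕ) :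
    ∃ N : ℕ, ∀ μ < n, P.val ((u - algebraMap k F c) ^ N * a μ) ≤ 1 := by
  have hex (μ : ℕ) : ∃ N : ℕ, P.val ((u - algebraMap k F c) ^ N * a μ) ≤ 1 := by
    rcases eq_or_ne (a μ) 0 with h0 | h0
    · exact ⟨0, by simp [h0]⟩
    · obtain ⟨e, he⟩ := P.exists_val_eq_zpow hu h (ha μ) h0
      refine ⟨e.natAbs, ?_⟩
      rw [map_mul, map_pow, he, ← zpow_natCast, ← zpow_add₀ (P.val_ne_zero hu)]
      obtain ⟨m, hm⟩ := Int.eq_ofNat_of_zero_le (show 0 ≤ (e.natAbs : ℤ) + e by omega)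
      rw [hm, zpow_natCast]
      exact pow_le_one' h.le m
  choose N hN using hex
  refine ⟨∑ μ ∈ Finset.range n, N μ, fun μ hμ => ?_⟩
  have hle := Finset.single_le_sum (f := N) (fun _ _ => Nat.zero_le _) (Finset.mem_range.2 hμ)
  refine le_trans ?_ (hN μ)
  rw [map_mul, map_mul, map_pow, map_pow]
  exact mul_le_mul_left (pow_le_pow_right_of_le_one' h.le hle) _

theorem smul_D_mem_differentials {a b : F} (ha : a ∈ P.localRing) (hb : b ∈ P.localRing) :
    a • KaehlerDifferential.D k F b ∈ P.differentials :=
  P.differentials.smul_mem (⟨a, ha⟩ : P.localRing.toSubring) (Submodule.subset_span ⟨b, hb, rfl⟩)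

theorem smul_D_mem_differentials_iff (hu : u ∈ P.localRing)
    (hD : KaehlerDifferential.D k F u ≠ 0) (h : ∀ a ∈ P.localRing, a ∈ P.regularDeriv u) {a : F} :
    a • KaehlerDifferential.D k F u ∈ P.differentials ↔ a ∈ P.localRing := by
  refine ⟨fun ha => ?_, fun ha => smul_D_mem_differentials ha hu⟩
  suffices hex : ∃ b ∈ P.localRing,
      a • KaehlerDifferential.D k F u = b • KaehlerDifferential.D k F u by
    obtain ⟨b, hb, e⟩ := hex
    rwa [smul_left_injective F hD e]
  generalize a • KaehlerDifferential.D k F u = ω at ha ⊢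
  induction ha using Submodule.span_induction with
  | mem ω hω =>
    obtain ⟨b, hb, rfl⟩ := hω
    exact (h b hb).2
  | zero => exact ⟨0, zero_mem _, (zero_smul _ _).symm⟩
  | add ω η _ _ ihω ihη =>
    obtain ⟨b, hb, rfl⟩ := ihω
    obtain ⟨b', hb', rfl⟩ := ihη
    exact ⟨b + b', add_mem hb hb', (add_smul _ _ _).symm⟩
  | smul s ω _ ih =>
    obtain ⟨b, hb, rfl⟩ := ih
    refine ⟨s * b, mul_mem s.2 hb, ?_⟩
    rw [mul_smul]
    exact (algebraMap_smul F s _).symm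

end CurvePoint

namespace ArtinSchreier.IsGenerator

variable {k F : Type*} [Field k] [Field F] [Algebra k F] {p : ℕ} [CharP k p] {u y : F} {c : k}
  {P : CurvePoint k F}

theorem exists_residue [IsAlgClosed k] (h : IsGenerator p (IntermediateField.adjoin k {u}) y)
    (hu : u - algebraMap k F c ≠ 0) (huP : P.val (u - algebraMap k F c) < 1)
    (hy : y ∈ P.localRing) :
    ∃ β : k, P.val (y - algebraMap k F β) < 1 ∧
      P.val ((y - algebraMap k F β) ^ p - (y - algebraMap k F β)) ≤
        P.val (u - algebraMap k F c) := by
  have := Fact.mk h.prime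
  have : CharP F p := (Algebra.charP_iff k F p).1 inferInstance
  obtain ⟨b, hb⟩ := CurvePoint.exists_val_sub_le_of_mem_adjoin hu huP h.pow_sub_mem
    (P.val_le_one_iff.2 (sub_mem (pow_mem hy p) hy))
  obtain ⟨β, hβ, hyβ⟩ := P.exists_isRoot_of_val_aeval_lt (P.val_le_one_iff.2 hy)
    (monic_X_pow_sub_X_sub_C h.prime.one_lt b).ne_zero (by simpa using hb.trans_lt huP)
  refine ⟨β, hyβ, ?_⟩
  have hβ' : algebraMap k F β ^ p - algebraMap k F β - algebraMap k F b = 0 := by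
    simpa using congrArg (algebraMap k F) hβ
  rwa [sub_pow_char, show y ^ p - algebraMap k F β ^ p - (y - algebraMap k F β) =
    y ^ p - y - algebraMap k F b by linear_combination -hβ']

theorem val_conj_le (hp : p.Prime) {z : F} (hz : P.val z < 1) {j : ℕ} (hj : ¬p ∣ j) :
    P.val ((z + j) ^ (p - 1) - 1) ≤ P.val (z ^ p - z) := by
  have := Fact.mk hp
  have : CharP F p := (Algebra.charP_iff k F p).1 inferInstance
  have hj1 : P.val (j : F) = 1 := by
    rw [← map_natCast (algebraMap k F)]
    exact P.val_algebraMap (by rwa [Ne, CharP.cast_eq_zero_iff k p])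
  have hunit : P.val (z + j) = 1 := by rw [P.val.map_add_eq_of_lt_right (by rwa [hj1]), hj1]
  have hfrob : (j : F) ^ p = j := by rw [← frobenius_def, map_natCast]
  have hmul : (z + j) * ((z + j) ^ (p - 1) - 1) = z ^ p - z := by
    rw [mul_sub, mul_one, mul_pow_sub_one hp.ne_zero, add_pow_char, hfrob]
    ring
  rw [← hmul, map_mul, hunit, one_mul]

/-- The unit `s = (y - β) ^ (p - 1) - 1` vanishes at all conjugates of `P`, so a high power of it
kills the poles which a function regular at `P` may have there. -/
theorem exists_unit_mul_eq_sum [IsAlgClosed k]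
    (h : IsGenerator p (IntermediateField.adjoin k {u}) y) (hu : u - algebraMap k F c ≠ 0)
    (huP : P.val (u - algebraMap k F c) < 1) (hy : y ∈ P.localRing) {a : F}
    (ha : a ∈ P.localRing) :
    ∃ s ∈ Algebra.adjoin k {y}, P.val s = 1 ∧ ∃ b : ℕ → F,
      (∀ μ < p, b μ ∈ IntermediateField.adjoin k {u} ∧ P.val (b μ) ≤ 1) ∧
        s * a = ∑ μ ∈ Finset.range p, b μ * y ^ μ := by
  obtain ⟨β, hβ, hβu⟩ := h.exists_residue hu huP hy
  obtain ⟨a', ha', rfl⟩ := h.exists_eq_sum a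
  obtain ⟨N, hN⟩ := CurvePoint.exists_forall_val_pow_mul_le_one hu huP ha' p
  have hsmem : ((y - algebraMap k F β) ^ (p - 1) - 1) ^ N ∈ Algebra.adjoin k {y} := by
    have hyβ := sub_mem (Algebra.self_mem_adjoin_singleton k y)
      (Subalgebra.algebraMap_mem (Algebra.adjoin k {y}) β)
    exact pow_mem (sub_mem (pow_mem hyβ _) (one_mem _)) N
  have hs : P.val (((y - algebraMap k F β) ^ (p - 1) - 1) ^ N) = 1 := by
    have hlt : P.val ((y - algebraMap k F β) ^ (p - 1)) < P.val 1 := by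
      rw [map_one, map_pow]
      exact pow_lt_one₀ zero_le hβ (Nat.sub_ne_zero_of_lt h.prime.one_lt)
    rw [map_pow, P.val.map_sub_eq_of_lt_right hlt, map_one, one_pow]
  obtain ⟨b, hb, hsum⟩ := h.exists_eq_sum (((y - algebraMap k F β) ^ (p - 1) - 1) ^ N *
    ∑ μ ∈ Finset.range p, a' μ * y ^ μ)
  refine ⟨_, hsmem, hs, b, fun μ hμ => ⟨hb μ, P.val_le_one_iff.2 ?_⟩, hsum⟩
  refine P.coeff_mem_of_sum_mem (p := p) hy (fun j hj => ?_) hμ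
  rcases Nat.eq_zero_or_pos j with rfl | hj0
  · simpa [← hsum] using mul_mem (P.val_le_one_iff.1 hs.le) ha
  obtain ⟨σ, hσ⟩ := h.exists_algHom j
  have hfix {z : F} (hz : z ∈ IntermediateField.adjoin k {u}) : σ z = z := σ.commutes ⟨z, hz⟩
  have hconj := congrArg σ hsum
  simp only [map_sum, map_mul, map_pow, map_sub, map_one, hσ, hfix (ha' _), hfix (hb _),
    hfix (algebraMap_mem _ β), add_sub_right_comm y (j : F)] at hconj
  have hle : ∑ μ ∈ Finset.range p, (u - algebraMap k F c) ^ N * a' μ * (y + j) ^ μ ∈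
      P.localRing := sum_mem fun ν hν => mul_mem
    (P.val_le_one_iff.1 (hN ν (Finset.mem_range.1 hν))) (pow_mem (add_mem hy (natCast_mem _ j)) ν)
  rw [← P.val_le_one_iff] at hle ⊢
  rw [← hconj, map_mul, map_pow]
  simp only [mul_assoc, ← Finset.mul_sum] at hle
  rw [map_mul, map_pow] at hle
  refine (mul_le_mul_left (pow_le_pow_left₀ zero_le ?_ N) _).trans hle
  exact (val_conj_le h.prime hβ (Nat.not_dvd_of_pos_of_lt hj0 hj)).trans hβu

theorem mem_regularDeriv [IsAlgClosed k]
    (h : IsGenerator p (IntermediateField.adjoin k {u}) y) (hu : u - algebraMap k F c ≠ 0)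
    (huP : P.val (u - algebraMap k F c) < 1) (hy : y ∈ P.localRing) {a : F}
    (ha : a ∈ P.localRing) : a ∈ P.regularDeriv u := by
  obtain ⟨s, hsy, hs, b, hb, hsum⟩ := h.exists_unit_mul_eq_sum hu huP hy ha
  have hyD : y ∈ P.regularDeriv u := CurvePoint.mem_regularDeriv_of_pow_sub_mem (p := p) hy
    (CurvePoint.mem_regularDeriv_of_mem_adjoin hu huP h.pow_sub_mem
      (P.val_le_one_iff.2 (sub_mem (pow_mem hy p) hy)))
  have hsD : s ∈ P.regularDeriv u := Algebra.adjoin_le (Set.singleton_subset_iff.2 hyD) hsy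
  have hs0 : s ≠ 0 := by rintro rfl; simp at hs
  rw [← inv_mul_cancel_left₀ hs0 a, hsum]
  refine mul_mem (CurvePoint.inv_mem_regularDeriv hsD hs) (sum_mem fun μ hμ => ?_)
  obtain ⟨hbK, hb1⟩ := hb μ (Finset.mem_range.1 hμ)
  exact mul_mem (CurvePoint.mem_regularDeriv_of_mem_adjoin hu huP hbK hb1) (pow_mem hyD μ)

end ArtinSchreier.IsGenerator

section AdjoinSimple

variable {k F : Type*} [Field k] [Field F] [Algebra k F]

theorem transcendental_sub_algebraMap {x : F} (hx : Transcendental k x) (c : k) :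
    Transcendental k (x - algebraMap k F c) := fun h =>
  hx (by simpa using h.add (isAlgebraic_algebraMap c))

theorem sub_algebraMap_ne_zero {x : F} (hx : Transcendental k x) (c : k) :
    x - algebraMap k F c ≠ 0 := fun h =>
  transcendental_sub_algebraMap hx c (h ▸ isAlgebraic_zero)

theorem ne_zero_of_transcendental {x : F} (hx : Transcendental k x) : x ≠ 0 := by
  simpa using sub_algebraMap_ne_zero hx 0

theorem transcendental_inv {x : F} (hx : Transcendental k x) : Transcendental k x⁻¹ := fun h =>
  hx (by simpa using h.inv)

theorem adjoin_simple_inv (x : F) :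
    IntermediateField.adjoin k {x⁻¹} = IntermediateField.adjoin k {x} := by
  refine le_antisymm (IntermediateField.adjoin_simple_le_iff.2 ?_)
    (IntermediateField.adjoin_simple_le_iff.2 ?_)
  · exact inv_mem (IntermediateField.mem_adjoin_simple_self k x)
  · simpa using inv_mem (IntermediateField.mem_adjoin_simple_self k x⁻¹)

theorem aeval_mem_adjoin_simple (x : F) (q : k[X]) :
    aeval x q ∈ IntermediateField.adjoin k {x} :=
  IntermediateField.algebra_adjoin_le_adjoin k {x} (aeval_mem_adjoin_singleton k x)

end AdjoinSimple

namespace ArtinSchreier.IsGenerator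

variable {k F : Type*} [Field k] [Field F] [Algebra k F] {p : ℕ} {x y : F} {c : k}
  {P : CurvePoint k F}

theorem D_ne_zero [CharP k p] (h : IsGenerator p (IntermediateField.adjoin k {x}) y)
    (hx : Transcendental k x) : KaehlerDifferential.D k F x ≠ 0 :=
  have := h.isSeparable
  D_ne_zero_of_transcendental hx

theorem exists_eq_smul_D [CharP k p] (h : IsGenerator p (IntermediateField.adjoin k {x}) y)
    (hx : Transcendental k x) (ω : Ω[F⁄k]) : ∃ a : F, ω = a • KaehlerDifferential.D k F x :=
  have := h.isSeparable
  exists_eq_smul_D_of_transcendental hx ω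

theorem smul_D_mem_differentials_iff [IsAlgClosed k] [CharP k p]
    (h : IsGenerator p (IntermediateField.adjoin k {x}) y) (hx : Transcendental k x)
    (hxP : P.val (x - algebraMap k F c) < 1) (hy : y ∈ P.localRing) {a : F} :
    a • KaehlerDifferential.D k F x ∈ P.differentials ↔ P.val a ≤ 1 := by
  rw [P.val_le_one_iff]
  exact CurvePoint.smul_D_mem_differentials_iff
    (P.val_le_one_iff.1 (P.val_le_one_of_val_sub_lt hxP)) (h.D_ne_zero hx)
    fun _ ha => h.mem_regularDeriv (sub_algebraMap_ne_zero hx c) hxP hy ha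

theorem smul_D_mem_differentials_iff_of_one_lt [IsAlgClosed k] [CharP k p]
    (h : IsGenerator p (IntermediateField.adjoin k {x}) y) (hx : Transcendental k x)
    (hxP : 1 < P.val x) (hy : y ∈ P.localRing) {a : F} :
    a • KaehlerDifferential.D k F x ∈ P.differentials ↔ P.val (a * x ^ 2) ≤ 1 := by
  have hx0 := ne_zero_of_transcendental hx
  rw [← adjoin_simple_inv] at h
  have hinv : P.val (x⁻¹ - algebraMap k F 0) < 1 := by
    rwa [map_zero, sub_zero, ← P.val.one_lt_val_iff hx0]
  have hD : a • KaehlerDifferential.D k F x =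
      -(a * x ^ 2) • KaehlerDifferential.D k F x⁻¹ := by
    rw [Derivation.leibniz_inv, smul_smul]
    congr 1
    field_simp
  rw [hD, h.smul_D_mem_differentials_iff (transcendental_inv hx) hinv hy, P.val.map_neg]

theorem exists_center [IsAlgClosed k] (h : IsGenerator p (IntermediateField.adjoin k {x}) y)
    (hx : x ∈ P.localRing) : ∃ c : k, P.val (x - algebraMap k F c) < 1 := by
  by_contra! hc
  have hx1 := P.val_le_one_iff.2 hx
  have hunit (q : k[X]) (hq : q ≠ 0) : P.val (aeval x q) = 1 := by
    refine (P.val_aeval_le hx1 q).antisymm (not_lt.1 fun hlt => ?_)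
    obtain ⟨β, -, hβ⟩ := P.exists_isRoot_of_val_aeval_lt hx1 hq hlt
    exact (hc β).not_gt hβ
  obtain ⟨a, ha, haP⟩ := h.exists_mem_notMem P
  obtain ⟨n, d, rfl⟩ := (IntermediateField.mem_adjoin_simple_iff k a).1 ha
  refine haP (P.val_le_one_iff.1 ?_)
  rcases eq_or_ne n 0 with rfl | hn
  · simp
  rcases eq_or_ne d 0 with rfl | hd
  · simp
  · simp [hunit n hn, hunit d hd]

end ArtinSchreier.IsGenerator

namespace ArtinSchreier

variable {k F : Type*} [Field k] [Field F] [Algebra k F] {r : ℕ} {ρ : Fin r → k}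

theorem aeval_prod_X_sub_C_pow (ρ : Fin r → k) (n : Fin r → ℕ) (x : F) :
    aeval x (∏ i, (X - C (ρ i)) ^ n i) = ∏ i, (x - algebraMap k F (ρ i)) ^ n i := by
  simp

theorem monic_prod_X_sub_C_pow (ρ : Fin r → k) (n : Fin r → ℕ) :
    (∏ i, (X - C (ρ i)) ^ n i).Monic :=
  monic_prod_of_monic _ _ fun _ _ => (monic_X_sub_C _).pow _

theorem natDegree_prod_X_sub_C_pow (ρ : Fin r → k) (n : Fin r → ℕ) :
    (∏ i, (X - C (ρ i)) ^ n i).natDegree = ∑ i, n i := by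
  rw [natDegree_prod_of_monic _ _ fun i _ => (monic_X_sub_C _).pow _]
  simp

theorem val_aeval_prod_of_eq (P : CurvePoint k F) (hρ : Function.Injective ρ) {x : F} {i : Fin r}
    (h : P.val (x - algebraMap k F (ρ i)) < 1) (n : Fin r → ℕ) :
    P.val (aeval x (∏ j, (X - C (ρ j)) ^ n j)) = P.val (x - algebraMap k F (ρ i)) ^ n i := by
  rw [← Finset.mul_prod_erase _ _ (Finset.mem_univ i), map_mul, map_mul,
    P.val_aeval_eq_one h (q := ∏ j ∈ Finset.univ.erase i, (X - C (ρ j)) ^ n j), mul_one]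
  · simp
  · rw [eval_prod, Finset.prod_ne_zero_iff]
    intro j hj
    simpa [sub_eq_zero] using fun h0 => absurd (hρ h0).symm (Finset.ne_of_mem_erase hj)

theorem val_aeval_prod_of_ne (P : CurvePoint k F) {x : F} {c : k}
    (h : P.val (x - algebraMap k F c) < 1) (hc : ∀ i, ρ i ≠ c) (n : Fin r → ℕ) :
    P.val (aeval x (∏ j, (X - C (ρ j)) ^ n j)) = 1 := by
  refine P.val_aeval_eq_one h ?_
  rw [eval_prod, Finset.prod_ne_zero_iff]
  intro j _
  simpa [sub_eq_zero] using fun h0 => absurd h0.symm (hc j)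

theorem val_aeval_prod_of_one_lt (P : CurvePoint k F) {x : F} (h : 1 < P.val x) (n : Fin r → ℕ) :
    P.val (aeval x (∏ j, (X - C (ρ j)) ^ n j)) = P.val x ^ ∑ i, n i := by
  rw [valuation_aeval_eq_valuation_X_pow_natDegree_of_one_lt_valuation_X x h
    (monic_prod_X_sub_C_pow ρ n).ne_zero, natDegree_prod_X_sub_C_pow]

/-- `F = k(x, y)` with `x` transcendental and `y ^ p - y = f(x) / ∏ i, (x - ρ_i) ^ l_i`, where the
right-hand side is reduced and regular at infinity, and has poles of orders prime to `p`. -/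
structure IsCover (p : ℕ) (ρ : Fin r → k) (l : Fin r → ℕ) (f : k[X]) (x y : F) : Prop where
  prime : p.Prime
  pos : 1 ≤ r
  injective : Function.Injective ρ
  one_le : ∀ i, 1 ≤ l i
  coprime : ∀ i, (l i).Coprime p
  isCoprime : IsCoprime f (∏ i, (X - C (ρ i)) ^ l i)
  natDegree_le : f.natDegree ≤ ∑ i, l i
  transcendental : Transcendental k x
  adjoin_eq_top : IntermediateField.adjoin k {x, y} = ⊤
  equation : y ^ p - y = aeval x f / ∏ i, (x - algebraMap k F (ρ i)) ^ l i

namespace IsCover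

variable {p : ℕ} {l : Fin r → ℕ} {f : k[X]} {x y : F} {P : CurvePoint k F} {i : Fin r}

theorem pow_sub_eq (H : IsCover p ρ l f x y) :
    y ^ p - y = aeval x f / aeval x (∏ i, (X - C (ρ i)) ^ l i) := by
  rw [aeval_prod_X_sub_C_pow, H.equation]

theorem ne_zero (H : IsCover p ρ l f x y) : x ≠ 0 :=
  ne_zero_of_transcendental H.transcendental

theorem sub_ne_zero (H : IsCover p ρ l f x y) (c : k) : x - algebraMap k F c ≠ 0 :=
  sub_algebraMap_ne_zero H.transcendental c

theorem aeval_ne_zero (H : IsCover p ρ l f x y) {q : k[X]} (hq : q ≠ 0) : aeval x q ≠ 0 :=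
  aeval_ne_zero_of_transcendental H.transcendental hq

theorem eval_f_ne_zero (H : IsCover p ρ l f x y) (i : Fin r) : f.eval (ρ i) ≠ 0 := by
  obtain ⟨a, b, hab⟩ := H.isCoprime
  have hprod : (∏ j, (X - C (ρ j)) ^ l j).eval (ρ i) = 0 := by
    rw [eval_prod]
    refine Finset.prod_eq_zero (Finset.mem_univ i) ?_
    simp [Nat.one_le_iff_ne_zero.1 (H.one_le i)]
  intro h
  simpa [h, hprod] using congrArg (eval (ρ i)) hab

theorem pow_sub_mem (H : IsCover p ρ l f x y) : y ^ p - y ∈ IntermediateField.adjoin k {x} := by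
  rw [H.pow_sub_eq]
  exact div_mem (aeval_mem_adjoin_simple x _) (aeval_mem_adjoin_simple x _)

theorem exists_point (H : IsCover p ρ l f x y) (c : k) :
    ∃ P : CurvePoint k F, P.val (x - algebraMap k F c) < 1 :=
  CurvePoint.exists_val_lt_one (transcendental_sub_algebraMap H.transcendental c)

theorem exists_point_infty (H : IsCover p ρ l f x y) : ∃ P : CurvePoint k F, 1 < P.val x := by
  obtain ⟨P, hP⟩ := CurvePoint.exists_val_lt_one (transcendental_inv H.transcendental)
  exact ⟨P, (P.val.one_lt_val_iff H.ne_zero).2 hP⟩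

theorem val_y_of_eq (H : IsCover p ρ l f x y) (h : P.val (x - algebraMap k F (ρ i)) < 1) :
    P.val y ^ p * P.val (x - algebraMap k F (ρ i)) ^ l i = 1 := by
  have hpole : P.val (y ^ p - y) * P.val (x - algebraMap k F (ρ i)) ^ l i = 1 := by
    rw [H.pow_sub_eq, map_div₀, P.val_aeval_eq_one h (H.eval_f_ne_zero i),
      val_aeval_prod_of_eq P H.injective h, div_mul_cancel₀]
    exact pow_ne_zero _ (P.val_ne_zero (H.sub_ne_zero _))
  have hy : 1 < P.val y := by
    by_contra! hy
    have hreg : P.val (y ^ p - y) ≤ 1 := P.val_le_one_iff.2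
      (sub_mem (pow_mem (P.val_le_one_iff.1 hy) _) (P.val_le_one_iff.1 hy))
    have hlt : P.val (x - algebraMap k F (ρ i)) ^ l i < 1 :=
      pow_lt_one₀ zero_le h (Nat.one_le_iff_ne_zero.1 (H.one_le i))
    exact absurd hpole ((mul_le_of_le_one_left' hreg).trans_lt hlt).ne
  rwa [P.val.map_sub_eq_of_lt_left, map_pow] at hpole
  rw [map_pow]
  exact lt_self_pow₀ hy H.prime.one_lt

theorem val_mul_pow_of_eq (H : IsCover p ρ l f x y) (h : P.val (x - algebraMap k F (ρ i)) < 1)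
    {a : F} {e : ℤ} (ha : P.val a = P.val (x - algebraMap k F (ρ i)) ^ e) (μ : ℕ) :
    P.val (a * y ^ μ) ^ p = P.val (x - algebraMap k F (ρ i)) ^ (p * e - l i * μ : ℤ) := by
  have hy : P.val y ^ p = P.val (x - algebraMap k F (ρ i)) ^ (-(l i : ℤ)) := by
    rw [zpow_neg, zpow_natCast]
    exact eq_inv_of_mul_eq_one_left (H.val_y_of_eq h)
  rw [map_mul, map_pow, mul_pow, ← pow_mul, mul_comm μ p, pow_mul, hy, ha, ← zpow_natCast,
    ← zpow_mul, ← zpow_natCast, ← zpow_mul, ← zpow_add₀ (P.val_ne_zero (H.sub_ne_zero _))]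
  congr 1
  ring

theorem not_dvd_mul (H : IsCover p ρ l f x y) (i : Fin r) {n : ℤ} (hn : n ≠ 0) (hnp : |n| < p) :
    ¬(p : ℤ) ∣ l i * n := fun h =>
  have hcop : IsCoprime (p : ℤ) (l i) := (Nat.isCoprime_iff_coprime.2 (H.coprime i)).symm
  hn (Int.eq_zero_of_abs_lt_dvd (hcop.dvd_of_dvd_mul_left h) hnp)

/-- At a point above `ρ i` the valuations of the terms differ modulo `p`, since `y` has a pole of
order `l i` there. -/
theorem val_le_val_sum (H : IsCover p ρ l f x y) (h : P.val (x - algebraMap k F (ρ i)) < 1)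
    {a : ℕ → F} (ha : ∀ μ, a μ ∈ IntermediateField.adjoin k {x}) {μ : ℕ} (hμ : μ < p) :
    P.val (a μ * y ^ μ) ≤ P.val (∑ ν ∈ Finset.range p, a ν * y ^ ν) := by
  refine valuation_le_valuation_sum_of_pairwise_ne P.val (a := fun ν => a ν * y ^ ν) ?_
    (Finset.mem_range.2 hμ)
  intro μ hμ ν hν hne hμ0 hν0 e
  rw [P.val.ne_zero_iff] at hμ0 hν0
  obtain ⟨m, hm⟩ := P.exists_val_eq_zpow (H.sub_ne_zero _) h (ha μ) (left_ne_zero_of_mul hμ0)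
  obtain ⟨n, hn⟩ := P.exists_val_eq_zpow (H.sub_ne_zero _) h (ha ν) (left_ne_zero_of_mul hν0)
  have hpow := congrArg (· ^ p) e
  simp only [H.val_mul_pow_of_eq h hm, H.val_mul_pow_of_eq h hn] at hpow
  have hexp := zpow_right_injective₀ (P.val_pos (H.sub_ne_zero _)) h.ne hpow
  rw [Finset.mem_range] at hμ hν
  refine H.not_dvd_mul i (n := μ - ν) (by omega) (by rw [abs_lt]; omega) ⟨m - n, ?_⟩
  linear_combination -hexp

theorem not_natDegree_minpoly_lt (H : IsCover p ρ l f x y) :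
    ¬(minpoly (IntermediateField.adjoin k {x}) y).natDegree < p := by
  intro hlt
  obtain ⟨P, hP⟩ := H.exists_point (ρ ⟨0, H.pos⟩)
  have hy : y ≠ 0 := by
    rintro rfl
    simpa [H.prime.ne_zero] using H.val_y_of_eq hP
  let q := minpoly (IntermediateField.adjoin k {x}) y
  have hsum : ∑ μ ∈ Finset.range p, (q.coeff μ : F) * y ^ μ = 0 := by
    rw [← minpoly.aeval (IntermediateField.adjoin k {x}) y, aeval_eq_sum_range' hlt]
    rfl
  have hlead := H.val_le_val_sum hP (a := fun μ => (q.coeff μ : F))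
    (fun μ => SetLike.coe_mem _) hlt
  have hmonic : q.coeff q.natDegree = 1 := minpoly.monic
    ⟨_, monic_X_pow_sub_X_sub_C H.prime.one_lt ⟨_, H.pow_sub_mem⟩, by simp⟩
  rw [hsum, map_zero, le_zero_iff, P.val.zero_iff] at hlead
  exact pow_ne_zero _ hy (by simpa [q, hmonic] using hlead)

theorem isGenerator (H : IsCover p ρ l f x y) :
    IsGenerator p (IntermediateField.adjoin k {x}) y where
  prime := H.prime
  pow_sub_mem := H.pow_sub_mem
  adjoin_eq_top := by
    rw [← IntermediateField.restrictScalars_eq_top_iff (K := k),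
      IntermediateField.adjoin_simple_adjoin_simple, H.adjoin_eq_top]
  natDegree_minpoly := by
    refine le_antisymm ?_ (not_lt.1 H.not_natDegree_minpoly_lt)
    rw [← natDegree_X_pow_sub_X_sub_C H.prime.one_lt (⟨_, H.pow_sub_mem⟩ :
      IntermediateField.adjoin k {x})]
    exact natDegree_le_of_dvd (minpoly.dvd _ _ (by simp))
      (monic_X_pow_sub_X_sub_C H.prime.one_lt _).ne_zero

theorem y_mem_of_ne (H : IsCover p ρ l f x y) {c : k} (h : P.val (x - algebraMap k F c) < 1)
    (hc : ∀ i, ρ i ≠ c) : y ∈ P.localRing := by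
  refine P.mem_of_pow_sub_mem H.prime.one_lt ?_
  rw [← P.val_le_one_iff, H.pow_sub_eq, map_div₀, val_aeval_prod_of_ne P h hc, div_one]
  exact P.val_aeval_le (P.val_le_one_of_val_sub_lt h) _

theorem y_mem_of_one_lt (H : IsCover p ρ l f x y) (h : 1 < P.val x) : y ∈ P.localRing := by
  refine P.mem_of_pow_sub_mem H.prime.one_lt ?_
  rw [← P.val_le_one_iff, H.pow_sub_eq, map_div₀, val_aeval_prod_of_one_lt P h]
  exact div_le_one_of_le₀ (P.val_aeval_le_pow h H.natDegree_le) zero_le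

theorem smul_D_mem_differentials_of_ne [IsAlgClosed k] [CharP k p] (H : IsCover p ρ l f x y)
    {c : k} (h : P.val (x - algebraMap k F c) < 1) (hc : ∀ i, ρ i ≠ c) {a : F} :
    a • KaehlerDifferential.D k F x ∈ P.differentials ↔ P.val a ≤ 1 :=
  H.isGenerator.smul_D_mem_differentials_iff H.transcendental h (H.y_mem_of_ne h hc)

theorem smul_D_mem_differentials_of_one_lt [IsAlgClosed k] [CharP k p] (H : IsCover p ρ l f x y)
    (h : 1 < P.val x) {a : F} :
    a • KaehlerDifferential.D k F x ∈ P.differentials ↔ P.val (a * x ^ 2) ≤ 1 :=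
  H.isGenerator.smul_D_mem_differentials_iff_of_one_lt H.transcendental h (H.y_mem_of_one_lt h)

theorem val_coeff_le_of_ne [CharP k p] (H : IsCover p ρ l f x y) {c : k}
    (h : P.val (x - algebraMap k F c) < 1) (hc : ∀ i, ρ i ≠ c) {a : ℕ → F}
    (ha : ∀ μ, a μ ∈ IntermediateField.adjoin k {x})
    (hreg : ∀ P' : CurvePoint k F, P'.val (x - algebraMap k F c) < 1 →
      ∑ μ ∈ Finset.range p, a μ * y ^ μ ∈ P'.localRing) {μ : ℕ} (hμ : μ < p) :
    P.val (a μ) ≤ 1 := by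
  refine P.val_le_one_iff.2 (H.isGenerator.coeff_mem P (H.y_mem_of_ne h hc) ha
    (fun P' hP' => hreg P' ?_) hμ)
  have hmem : (x - algebraMap k F c)⁻¹ ∈ IntermediateField.adjoin k {x} :=
    inv_mem (sub_mem (IntermediateField.mem_adjoin_simple_self k x) (algebraMap_mem _ c))
  rw [Valuation.val_lt_one_iff _ (H.sub_ne_zero c), ← not_le, CurvePoint.val_le_one_iff] at h ⊢
  rwa [hP' _ hmem]

theorem val_coeff_le_of_one_lt [CharP k p] (H : IsCover p ρ l f x y) (h : 1 < P.val x)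
    {a : ℕ → F} (ha : ∀ μ, a μ ∈ IntermediateField.adjoin k {x})
    (hreg : ∀ P' : CurvePoint k F, 1 < P'.val x →
      ∑ μ ∈ Finset.range p, a μ * y ^ μ ∈ P'.localRing) {μ : ℕ} (hμ : μ < p) :
    P.val (a μ) ≤ 1 := by
  refine P.val_le_one_iff.2 (H.isGenerator.coeff_mem P (H.y_mem_of_one_lt h) ha
    (fun P' hP' => hreg P' ?_) hμ)
  rw [← not_le, CurvePoint.val_le_one_iff] at h ⊢
  rwa [hP' _ (IntermediateField.mem_adjoin_simple_self k x)]

end IsCover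

end ArtinSchreier

namespace CurvePoint

variable {k F : Type*} [Field k] [Field F] [Algebra k F] {P : CurvePoint k F} {u : F} {c : k}

theorem exists_D_eq_mul_smul_of_mem_adjoin (hu : u - algebraMap k F c ≠ 0)
    (h : P.val (u - algebraMap k F c) < 1) {a : F}
    (ha : a ∈ IntermediateField.adjoin k {u}) (ha0 : a ≠ 0) :
    ∃ s : F, KaehlerDifferential.D k F a = (a * s) • KaehlerDifferential.D k F u ∧
      P.val s * P.val (u - algebraMap k F c) ≤ 1 := by
  obtain ⟨e, he⟩ := P.exists_val_eq_zpow hu h ha ha0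
  set ξ := u - algebraMap k F c with hξ
  have hξK : ξ ∈ IntermediateField.adjoin k {u} :=
    sub_mem (IntermediateField.mem_adjoin_simple_self k u) (IntermediateField.algebraMap_mem _ c)
  have hDξ : KaehlerDifferential.D k F ξ = KaehlerDifferential.D k F u := by simp [hξ]
  have hunit : P.val (a / ξ ^ e) = 1 := by
    rw [map_div₀, map_zpow₀, he, div_self (zpow_ne_zero _ (P.val_ne_zero hu))]
  obtain ⟨-, b, hb, hDb⟩ := mem_regularDeriv_of_mem_adjoin hu h
    (div_mem ha (zpow_mem hξK e)) hunit.le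
  refine ⟨b / (a / ξ ^ e) + e / ξ, ?_, ?_⟩
  · rw [← div_mul_cancel₀ a (zpow_ne_zero e hu), Derivation.leibniz, Derivation.leibniz_zpow, hDξ,
      hDb, ← Int.cast_smul_eq_zsmul F, smul_smul, smul_smul, smul_smul, ← add_smul,
      zpow_sub_one₀ hu]
    congr 1
    field_simp
    ring
  · rw [← map_mul, add_mul, div_mul_cancel₀ _ hu]
    refine P.val.map_add_le ?_ (P.val_le_one_iff.2 (intCast_mem P.localRing e))
    rw [map_mul, map_div₀, hunit, div_one]
    exact mul_le_one' (P.val_le_one_iff.2 hb) h.le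

end CurvePoint

theorem exists_mul_sub_mul_eq_one {p l : ℕ} (hp : 1 < p) (h : l.Coprime p) :
    ∃ (e : ℤ) (b : ℕ), ¬p ∣ b ∧ (p * e - l * b : ℤ) = 1 := by
  obtain ⟨u, v, huv⟩ := Nat.isCoprime_iff_coprime.2 h.symm
  obtain ⟨b, hb⟩ := Int.eq_ofNat_of_zero_le (Int.emod_nonneg (-v) (by omega : (p : ℤ) ≠ 0))
  have hdiv := Int.mul_ediv_add_emod (-v) p
  rw [hb] at hdiv
  have hbezout : (p * (u - l * (-v / p)) - l * b : ℤ) = 1 := by linear_combination huv - l * hdiv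
  refine ⟨_, b, fun hpb => ?_, hbezout⟩
  have hdvd : (p : ℤ) ∣ 1 := hbezout ▸ dvd_sub (dvd_mul_right _ _)
    ((Int.natCast_dvd_natCast.2 hpb).mul_left _)
  exact hp.ne' (by exact_mod_cast Int.eq_one_of_dvd_one (Int.natCast_nonneg p) hdvd)

namespace ArtinSchreier

variable {k F : Type*} [Field k] [Field F] [Algebra k F] {r : ℕ}

theorem derivative_prod_X_sub_C_pow_mul (ρ : Fin r → k) (l : Fin r → ℕ) :
    derivative (∏ i, (X - C (ρ i)) ^ l i) * ∏ i, (X - C (ρ i)) =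
      (∏ i, (X - C (ρ i)) ^ l i) *
        ∑ i, C (l i : k) * ∏ j ∈ Finset.univ.erase i, (X - C (ρ j)) := by
  rw [derivative_prod_finset, Finset.sum_mul, Finset.mul_sum]
  refine Finset.sum_congr rfl fun i _ => ?_
  rw [← Finset.mul_prod_erase _ (fun i => (X - C (ρ i)) ^ l i) (Finset.mem_univ i),
    ← Finset.mul_prod_erase _ (fun i => X - C (ρ i)) (Finset.mem_univ i), derivative_X_sub_C_pow]
  rcases Nat.eq_zero_or_pos (l i) with h | h
  · simp [h]
  · rw [← Nat.sub_one_add_one h.ne', pow_succ, Nat.add_sub_cancel]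
    ring

namespace IsCover

variable {p : ℕ} {ρ : Fin r → k} {l : Fin r → ℕ} {f : k[X]} {x y : F} {P : CurvePoint k F}
  {i : Fin r}

theorem D_y [CharP k p] (H : IsCover p ρ l f x y) : KaehlerDifferential.D k F y =
    (aeval x (psi ρ l f) / ∏ i, (x - algebraMap k F (ρ i)) ^ (l i + 1)) •
      KaehlerDifferential.D k F x := by
  have hd := H.aeval_ne_zero (monic_prod_X_sub_C_pow ρ l).ne_zero
  have hd1 : aeval x (∏ i, (X - C (ρ i))) ≠ 0 :=
    H.aeval_ne_zero (monic_prod_of_monic _ _ fun i _ => monic_X_sub_C (ρ i)).ne_zero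
  have hlog := congrArg (aeval x) (derivative_prod_X_sub_C_pow_mul ρ l)
  rw [map_mul, map_mul] at hlog
  have hprod : ∏ i, (x - algebraMap k F (ρ i)) ^ (l i + 1) =
      aeval x (∏ i, (X - C (ρ i)) ^ l i) * aeval x (∏ i, (X - C (ρ i))) := by
    simp [pow_succ, Finset.prod_mul_distrib]
  rw [← neg_neg (KaehlerDifferential.D k F y), ← D_pow_sub_self p, H.pow_sub_eq,
    Derivation.leibniz_div, Derivation.map_aeval, Derivation.map_aeval, smul_smul, smul_smul,
    ← sub_smul, smul_smul, ← neg_smul, hprod, psi]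
  congr 1
  simp only [map_sub, map_mul]
  field_simp
  linear_combination aeval x f * hlog

theorem eval_psi_ne_zero [CharP k p] (H : IsCover p ρ l f x y) (i : Fin r) :
    (psi ρ l f).eval (ρ i) ≠ 0 := by
  have hl : (l i : k) ≠ 0 := by
    rw [Ne, CharP.cast_eq_zero_iff k p, ← H.prime.coprime_iff_not_dvd]
    exact (H.coprime i).symm
  have hzero : (∏ j, (X - C (ρ j))).eval (ρ i) = 0 := by
    rw [eval_prod]
    exact Finset.prod_eq_zero (Finset.mem_univ i) (by simp)
  have hsum : (∑ i, C (l i : k) * ∏ j ∈ Finset.univ.erase i, (X - C (ρ j))).eval (ρ i) =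
      l i * ∏ j ∈ Finset.univ.erase i, (ρ i - ρ j) := by
    rw [eval_finsetSum, Finset.sum_eq_single_of_mem i (Finset.mem_univ i)]
    · simp [eval_prod]
    · intro j _ hj
      rw [eval_mul, eval_prod,
        Finset.prod_eq_zero (Finset.mem_erase.2 ⟨hj.symm, Finset.mem_univ i⟩) (by simp), mul_zero]
  rw [psi, eval_sub, eval_mul, eval_mul, hzero, hsum, mul_zero, sub_zero]
  refine mul_ne_zero (H.eval_f_ne_zero i) (mul_ne_zero hl (Finset.prod_ne_zero_iff.2 ?_))
  intro j hj
  simpa [_root_.sub_eq_zero] using fun h => Finset.ne_of_mem_erase hj (H.injective h).symm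

theorem val_psi_div_prod [CharP k p] (H : IsCover p ρ l f x y)
    (h : P.val (x - algebraMap k F (ρ i)) < 1) :
    P.val (aeval x (psi ρ l f) / ∏ i, (x - algebraMap k F (ρ i)) ^ (l i + 1)) =
      (P.val (x - algebraMap k F (ρ i)) ^ (l i + 1))⁻¹ := by
  rw [← aeval_prod_X_sub_C_pow ρ fun i => l i + 1, map_div₀,
    P.val_aeval_eq_one h (H.eval_psi_ne_zero i),
    val_aeval_prod_of_eq P H.injective h fun i => l i + 1, one_div]

theorem le_sub_one_mul (H : IsCover p ρ l f x y) (i : Fin r) : p ≤ (p - 1) * (l i + 1) := by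
  have hlt := lt_mul_of_one_lt_right (Nat.sub_pos_of_lt H.prime.one_lt)
    (show 1 < l i + 1 from Nat.lt_add_one_of_le (H.one_le i))
  omega

theorem val_psi_div_prod_div_y [CharP k p] (H : IsCover p ρ l f x y)
    (h : P.val (x - algebraMap k F (ρ i)) < 1) :
    P.val (aeval x (psi ρ l f) / (∏ i, (x - algebraMap k F (ρ i)) ^ (l i + 1)) / y) ^ p *
      P.val (x - algebraMap k F (ρ i)) ^ ((p - 1) * (l i + 1) + 1) = 1 := by
  have hexp : (l i + 1) * p = (p - 1) * (l i + 1) + 1 + l i := by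
    obtain ⟨q, rfl⟩ := Nat.exists_eq_add_of_le' H.prime.one_lt.le
    rw [Nat.add_sub_cancel]
    ring
  have hξ := P.val_ne_zero (H.sub_ne_zero (ρ i))
  rw [map_div₀, H.val_psi_div_prod h, div_pow, inv_pow, ← pow_mul, hexp, pow_add _ _ (l i),
    eq_div_of_mul_eq (pow_ne_zero _ hξ) (H.val_y_of_eq h)]
  field_simp

/-- The second term of the logarithmic derivative `a' / a + μ y' / y` of `a * y ^ μ` dominates. -/
theorem exists_D_eq_mul_smul [CharP k p] (H : IsCover p ρ l f x y)
    (h : P.val (x - algebraMap k F (ρ i)) < 1) {a : F}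
    (ha : a ∈ IntermediateField.adjoin k {x}) (ha0 : a ≠ 0) {μ : ℕ} (hμ : ¬p ∣ μ) :
    ∃ s : F, KaehlerDifferential.D k F (a * y ^ μ) =
        (a * y ^ μ * s) • KaehlerDifferential.D k F x ∧
      P.val s ^ p * P.val (x - algebraMap k F (ρ i)) ^ ((p - 1) * (l i + 1) + 1) = 1 := by
  obtain ⟨s, hs, hsv⟩ := CurvePoint.exists_D_eq_mul_smul_of_mem_adjoin (H.sub_ne_zero _) h ha ha0
  have hDy := H.D_y
  have hη := H.val_psi_div_prod_div_y h
  set η := aeval x (psi ρ l f) / ∏ i, (x - algebraMap k F (ρ i)) ^ (l i + 1)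
  set N := (p - 1) * (l i + 1)
  have hN : p ≤ N := H.le_sub_one_mul i
  have hξ := P.val_pos (H.sub_ne_zero (ρ i))
  have hy : y ≠ 0 := by
    rintro rfl
    simp [H.prime.ne_zero] at hη
  have hμ0 : μ ≠ 0 := fun h0 => hμ (h0 ▸ dvd_zero p)
  have hμ1 : P.val (μ : F) = 1 := by
    rw [← map_natCast (algebraMap k F)]
    exact P.val_algebraMap (by rwa [Ne, CharP.cast_eq_zero_iff k p])
  have hlt : P.val s < P.val (μ * (η / y)) := by
    rw [map_mul, hμ1, one_mul]
    refine lt_of_pow_lt_pow_left₀ p zero_le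
      ((mul_lt_mul_iff_left₀ (pow_pos hξ (N + 1))).1 (lt_of_lt_of_eq ?_ hη.symm))
    rw [← Nat.add_sub_cancel' (show p ≤ N + 1 by omega), pow_add, ← mul_assoc, ← mul_pow]
    exact (mul_le_of_le_one_left' (pow_le_one₀ zero_le hsv)).trans_lt
      (pow_lt_one₀ zero_le h (by omega))
  refine ⟨s + μ * (η / y), ?_, ?_⟩
  · rw [Derivation.leibniz, Derivation.leibniz_pow, hs, hDy, ← Nat.cast_smul_eq_nsmul F,
      ← mul_pow_sub_one hμ0 y]
    simp only [smul_smul, ← add_smul]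
    congr 1
    field_simp
    ring
  · rwa [P.val.map_add_eq_of_lt_right hlt, map_mul, hμ1, one_mul]

theorem exists_D_mul_pow_eq_smul [CharP k p] (H : IsCover p ρ l f x y)
    (h : P.val (x - algebraMap k F (ρ i)) < 1) {a : F}
    (ha : a ∈ IntermediateField.adjoin k {x}) {μ : ℕ} (hμ : μ < p)
    (hreg : P.val (a * y ^ μ) ≤ 1) :
    ∃ b : F, KaehlerDifferential.D k F (a * y ^ μ) = b • KaehlerDifferential.D k F x ∧
      P.val b ^ p * P.val (x - algebraMap k F (ρ i)) ^ ((p - 1) * (l i + 1)) ≤ 1 := by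
  rcases eq_or_ne a 0 with rfl | ha0
  · exact ⟨0, by simp [H.prime.ne_zero]⟩
  have hξ := P.val_pos (H.sub_ne_zero (ρ i))
  rcases Nat.eq_zero_or_pos μ with rfl | hμ0
  · obtain ⟨s, hs, hsv⟩ :=
      CurvePoint.exists_D_eq_mul_smul_of_mem_adjoin (H.sub_ne_zero _) h ha ha0
    rw [pow_zero, mul_one] at hreg
    refine ⟨a * s, by rwa [pow_zero, mul_one], ?_⟩
    rw [← Nat.add_sub_cancel' (H.le_sub_one_mul i), pow_add, ← mul_assoc, ← mul_pow, map_mul,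
      mul_assoc (P.val a)]
    exact mul_le_one' (pow_le_one₀ zero_le (mul_le_one' hreg hsv)) (pow_le_one₀ zero_le h.le)
  · obtain ⟨s, hs, hsv⟩ := H.exists_D_eq_mul_smul h ha ha0 (Nat.not_dvd_of_pos_of_lt hμ0 hμ)
    obtain ⟨e, he⟩ := P.exists_val_eq_zpow (H.sub_ne_zero _) h ha ha0
    have hpow := pow_le_one₀ (n := p) zero_le hreg
    have hne : (p * e - l i * μ : ℤ) ≠ 0 := fun h0 =>
      H.not_dvd_mul i (n := μ) (by omega) (by rw [abs_lt]; omega) ⟨e, by linear_combination -h0⟩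
    have hlt : P.val (a * y ^ μ) ^ p ≤ P.val (x - algebraMap k F (ρ i)) ^ (1 : ℤ) := by
      rw [H.val_mul_pow_of_eq h he, ← zpow_zero (P.val (x - algebraMap k F (ρ i))),
        zpow_le_zpow_iff_right_of_lt_one₀ hξ h] at *
      omega
    refine ⟨_, hs, ?_⟩
    calc P.val (a * y ^ μ * s) ^ p * P.val (x - algebraMap k F (ρ i)) ^ ((p - 1) * (l i + 1))
        = P.val (a * y ^ μ) ^ p *
            (P.val s ^ p * P.val (x - algebraMap k F (ρ i)) ^ ((p - 1) * (l i + 1))) := by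
          rw [map_mul, mul_pow, mul_assoc]
      _ ≤ P.val (x - algebraMap k F (ρ i)) ^ (1 : ℤ) *
            (P.val s ^ p * P.val (x - algebraMap k F (ρ i)) ^ ((p - 1) * (l i + 1))) :=
          mul_le_mul_left hlt _
      _ = 1 := by rw [zpow_one, ← hsv, pow_succ', mul_left_comm]

/-- A uniformizer at a point above `ρ i` is `(x - ρ i) ^ e * y ^ b` with `p * e - l i * b = 1`. -/
theorem exists_uniformizer [CharP k p] (H : IsCover p ρ l f x y)
    (h : P.val (x - algebraMap k F (ρ i)) < 1) :
    ∃ u ∈ P.localRing, ∃ u' : F,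
      KaehlerDifferential.D k F u = u' • KaehlerDifferential.D k F x ∧
      P.val u' ^ p * P.val (x - algebraMap k F (ρ i)) ^ ((p - 1) * (l i + 1)) = 1 := by
  obtain ⟨e, b, hb, heb⟩ := exists_mul_sub_mul_eq_one H.prime.one_lt (H.coprime i)
  have hξK : (x - algebraMap k F (ρ i)) ^ e ∈ IntermediateField.adjoin k {x} := zpow_mem
    (sub_mem (IntermediateField.mem_adjoin_simple_self k x)
      (IntermediateField.algebraMap_mem _ (ρ i))) e
  obtain ⟨s, hs, hsv⟩ := H.exists_D_eq_mul_smul h hξK (zpow_ne_zero e (H.sub_ne_zero _)) hb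
  have hval := H.val_mul_pow_of_eq h (map_zpow₀ P.val (x - algebraMap k F (ρ i)) e) b
  rw [heb, zpow_one] at hval
  refine ⟨_, P.val_le_one_iff.1 ?_, _, hs, ?_⟩
  · rw [← pow_le_one_iff_of_nonneg zero_le H.prime.ne_zero, hval]
    exact h.le
  · rw [map_mul, mul_pow, hval, ← hsv, pow_succ', mul_assoc, mul_left_comm]

theorem exists_D_eq_smul_of_mem [CharP k p] (H : IsCover p ρ l f x y)
    (h : P.val (x - algebraMap k F (ρ i)) < 1) {a : F} (ha : a ∈ P.localRing) :
    ∃ b : F, KaehlerDifferential.D k F a = b • KaehlerDifferential.D k F x ∧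
      P.val b ^ p * P.val (x - algebraMap k F (ρ i)) ^ ((p - 1) * (l i + 1)) ≤ 1 := by
  obtain ⟨-, -, u', -, hu'⟩ := H.exists_uniformizer h
  have hiff (b : F) : P.val b ^ p * P.val (x - algebraMap k F (ρ i)) ^ ((p - 1) * (l i + 1)) ≤ 1 ↔
      P.val b ≤ P.val u' := by
    rw [← hu', mul_le_mul_iff_left₀ (pow_pos (P.val_pos (H.sub_ne_zero (ρ i))) _),
      pow_le_pow_iff_left₀ zero_le zero_le H.prime.ne_zero]
  obtain ⟨c, hc, rfl⟩ := H.isGenerator.exists_eq_sum a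
  have hterm (μ : ℕ) (hμ : μ ∈ Finset.range p) :=
    H.exists_D_mul_pow_eq_smul h (hc μ) (Finset.mem_range.1 hμ)
      ((H.val_le_val_sum h hc (Finset.mem_range.1 hμ)).trans (P.val_le_one_iff.2 ha))
  choose! b hDb hb using hterm
  refine ⟨∑ μ ∈ Finset.range p, b μ, ?_, ?_⟩
  · rw [map_sum, Finset.sum_smul]
    exact Finset.sum_congr rfl hDb
  · exact (hiff _).2 (P.val.map_sum_le fun μ hμ => (hiff _).1 (hb μ hμ))

theorem smul_D_mem_differentials_of_eq [CharP k p] (H : IsCover p ρ l f x y)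
    (h : P.val (x - algebraMap k F (ρ i)) < 1) {a : F} :
    a • KaehlerDifferential.D k F x ∈ P.differentials ↔
      P.val a ^ p * P.val (x - algebraMap k F (ρ i)) ^ ((p - 1) * (l i + 1)) ≤ 1 := by
  obtain ⟨u, hu, u', hDu, hu'⟩ := H.exists_uniformizer h
  have hu'0 : u' ≠ 0 := by
    rintro rfl
    simp [H.prime.ne_zero] at hu'
  have hiff (b : F) : b / u' ∈ P.localRing ↔
      P.val b ^ p * P.val (x - algebraMap k F (ρ i)) ^ ((p - 1) * (l i + 1)) ≤ 1 := by
    rw [← P.val_le_one_iff, ← pow_le_one_iff_of_nonneg zero_le H.prime.ne_zero, map_div₀, div_pow,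
      div_eq_mul_inv, inv_eq_of_mul_eq_one_right hu']
  have hsmul (b : F) : b • KaehlerDifferential.D k F x =
      (b / u') • KaehlerDifferential.D k F u := by
    rw [hDu, smul_smul, div_mul_cancel₀ _ hu'0]
  have hDu0 : KaehlerDifferential.D k F u ≠ 0 := by
    rw [hDu]
    exact smul_ne_zero hu'0 (H.isGenerator.D_ne_zero H.transcendental)
  rw [← hiff, hsmul, CurvePoint.smul_D_mem_differentials_iff hu hDu0]
  intro b hb
  obtain ⟨b', hDb, hb'⟩ := H.exists_D_eq_smul_of_mem h hb
  exact ⟨hb, b' / u', (hiff b').2 hb', by rw [hDb, hsmul]⟩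

end IsCover

end ArtinSchreier

namespace CurvePoint

variable {k F : Type*} [Field k] [Field F] [Algebra k F] {P : CurvePoint k F} {x : F} {c : k}

theorem smul_mem_differentials {z : F} (hz : P.val z ≤ 1) {ω : Ω[F⁄k]} (hω : ω ∈ P.differentials) :
    z • ω ∈ P.differentials :=
  P.differentials.smul_mem (⟨z, P.val_le_one_iff.1 hz⟩ : P.localRing.toSubring) hω

theorem mem_openInfty_iff : P ∈ openInfty k x ↔ P.val x ≤ 1 :=
  not_not.trans P.val_le_one_iff.symm

theorem mem_openZero_iff : P ∈ openZero k x ↔ 1 ≤ P.val x := by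
  rw [← not_lt, openZero, Set.mem_compl_iff, not_iff_not, fibre, Set.mem_ofPred_eq, map_zero,
    sub_zero]
  exact P.localRing.mem_nonunits_iff

theorem val_eq_one_of_val_sub_lt (hc : c ≠ 0) (h : P.val (x - algebraMap k F c) < 1) :
    P.val x = 1 := by
  simpa using P.val_aeval_eq_one h (q := X) (by simpa using hc)

end CurvePoint

namespace ArtinSchreier

theorem le_m_iff {p μ : ℕ} (hμ : μ < p) (l : ℕ) {e : ℤ} :
    e ≤ m p μ l ↔ p * e ≤ (p - 1 - μ) * l + (p - 1) := by
  rw [m, Int.natCast_ediv, Int.le_ediv_iff_mul_le (by omega), mul_comm]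
  push_cast [Nat.cast_sub (show μ ≤ p - 1 by omega), Nat.cast_sub (show 1 ≤ p by omega)]
  rfl

theorem m_le_iff {p μ : ℕ} (hμ : μ < p) (l : ℕ) {e : ℤ} :
    m p μ l ≤ e ↔ (p - 1 - μ) * l ≤ p * e := by
  rw [← Int.lt_add_one_iff, ← not_le, le_m_iff hμ, not_le, mul_add, mul_one]
  constructor <;> intro h <;> linarith

theorem m_pred {p : ℕ} (hp : 0 < p) (l : ℕ) : m p (p - 1) l = 0 := by
  rw [m, Nat.sub_self, zero_mul, zero_add, Nat.div_eq_of_lt (Nat.sub_one_lt_of_lt hp)]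

theorem m_le {p μ : ℕ} (hμ : μ < p) (l : ℕ) : m p μ l ≤ l := by
  rw [← Nat.cast_le (α := ℤ), m_le_iff hμ]
  nlinarith

theorem lt_m_add_m {p μ l : ℕ} (hl : l.Coprime p) (hμ : 2 ≤ μ) (hμp : μ ≤ p) :
    l < m p (p - μ) l + m p (μ - 2) l := by
  have h₁ := (m_le_iff (show p - μ < p by omega) l).1 le_rfl
  have h₂ := (m_le_iff (show μ - 2 < p by omega) l).1 le_rfl
  push_cast [Nat.cast_sub hμp, Nat.cast_sub hμ] at h₁ h₂
  have hne : ((μ - 1) * l : ℤ) ≠ p * m p (p - μ) l := fun h => by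
    have hdvd : p ∣ (μ - 1) * l := by
      zify [show 1 ≤ μ by omega]
      exact ⟨_, h⟩
    exact Nat.not_dvd_of_pos_of_lt (by omega) (by omega) (hl.symm.dvd_of_dvd_mul_right hdvd)
  have hlt : (p * l : ℤ) < p * (m p (p - μ) l + m p (μ - 2) l : ℕ) := by
    have := lt_of_le_of_ne (show ((μ - 1) * l : ℤ) ≤ p * m p (p - μ) l by linarith) hne
    push_cast
    linarith
  exact_mod_cast lt_of_mul_lt_mul_left hlt (by positivity)

section Polynomials

variable {k F : Type*} [Field k] [Field F] [Algebra k F] {r : ℕ}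

theorem t_pred {p : ℕ} (hp : 0 < p) (l : Fin r → ℕ) : t p l (p - 1) = 0 := by
  simp [t, m_pred hp]

theorem t_le {p μ : ℕ} (hμ : μ < p) (l : Fin r → ℕ) : t p l μ ≤ ∑ i, l i :=
  Finset.sum_le_sum fun i _ => m_le hμ (l i)

theorem g_pred {p : ℕ} (hp : 0 < p) (ρ : Fin r → k) (l : Fin r → ℕ) : g p ρ l (p - 1) = 1 := by
  simp [g, m_pred hp]

theorem g_ne_zero (p : ℕ) (ρ : Fin r → k) (l : Fin r → ℕ) (μ : ℕ) : g p ρ l μ ≠ 0 :=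
  (monic_prod_X_sub_C_pow ρ _).ne_zero

variable {p : ℕ} {ρ : Fin r → k} {x : F}

theorem val_g_of_ne (P : CurvePoint k F) {c : k} (h : P.val (x - algebraMap k F c) < 1)
    (hc : ∀ i, ρ i ≠ c) (l : Fin r → ℕ) (μ : ℕ) : P.val (aeval x (g p ρ l μ)) = 1 :=
  val_aeval_prod_of_ne P h hc _

theorem val_g_of_one_lt (P : CurvePoint k F) (h : 1 < P.val x) (l : Fin r → ℕ) (μ : ℕ) :
    P.val (aeval x (g p ρ l μ)) = P.val x ^ t p l μ :=
  val_aeval_prod_of_one_lt P h _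

end Polynomials

namespace IsCover

variable {k F : Type*} [Field k] [Field F] [Algebra k F] {r p : ℕ} {ρ : Fin r → k}
  {l : Fin r → ℕ} {f : k[X]} {x y : F} {P : CurvePoint k F} {i : Fin r} {c : k}

theorem one_le_t (H : IsCover p ρ l f x y) {μ : ℕ} (hμ : μ + 1 < p) : 1 ≤ t p l μ := by
  have hm : 1 ≤ m p μ (l ⟨0, H.pos⟩) := by
    rw [m, Nat.one_le_div_iff (by omega)]
    have := Nat.mul_le_mul (show 1 ≤ p - 1 - μ by omega) (H.one_le ⟨0, H.pos⟩)
    omega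
  exact hm.trans (Finset.single_le_sum (f := fun i => m p μ (l i)) (fun _ _ => Nat.zero_le _)
    (Finset.mem_univ _))

theorem aeval_g_ne_zero (H : IsCover p ρ l f x y) (μ : ℕ) : aeval x (g p ρ l μ) ≠ 0 :=
  H.aeval_ne_zero (g_ne_zero p ρ l μ)

theorem val_g_of_eq (H : IsCover p ρ l f x y) (h : P.val (x - algebraMap k F (ρ i)) < 1) (μ : ℕ) :
    P.val (aeval x (g p ρ l μ)) = P.val (x - algebraMap k F (ρ i)) ^ (m p μ (l i) : ℤ) := by
  rw [zpow_natCast]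
  exact val_aeval_prod_of_eq P H.injective h _

theorem val_zpow_le_one_iff (H : IsCover p ρ l f x y) (h : P.val (x - algebraMap k F c) < 1)
    {n : ℤ} : P.val (x - algebraMap k F c) ^ n ≤ 1 ↔ 0 ≤ n := by
  rw [← zpow_zero (P.val (x - algebraMap k F c)),
    zpow_le_zpow_iff_right_of_lt_one₀ (P.val_pos (H.sub_ne_zero c)) h]

theorem mul_pow_mem_iff_of_eq (H : IsCover p ρ l f x y)
    (h : P.val (x - algebraMap k F (ρ i)) < 1) {a : F}
    (ha : a ∈ IntermediateField.adjoin k {x}) {μ : ℕ} (hμ : μ < p) :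
    a * y ^ μ ∈ P.localRing ↔ P.val (a / aeval x (g p ρ l (p - 1 - μ))) ≤ 1 := by
  rcases eq_or_ne a 0 with rfl | ha0
  · simp
  obtain ⟨e, he⟩ := P.exists_val_eq_zpow (H.sub_ne_zero _) h ha ha0
  rw [← P.val_le_one_iff, ← pow_le_one_iff_of_nonneg zero_le H.prime.ne_zero,
    H.val_mul_pow_of_eq h he, H.val_zpow_le_one_iff h, map_div₀, he, H.val_g_of_eq h,
    ← zpow_sub₀ (P.val_ne_zero (H.sub_ne_zero _)), H.val_zpow_le_one_iff h, sub_nonneg, sub_nonneg,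
    m_le_iff (by omega)]
  push_cast [Nat.cast_sub (show μ ≤ p - 1 by omega), Nat.cast_sub H.prime.one_le]
  rw [sub_sub_cancel, mul_comm]

theorem mul_pow_smul_D_mem_iff_of_eq [CharP k p] (H : IsCover p ρ l f x y)
    (h : P.val (x - algebraMap k F (ρ i)) < 1) {a : F}
    (ha : a ∈ IntermediateField.adjoin k {x}) {μ : ℕ} (hμ : μ < p) :
    (a * y ^ μ) • KaehlerDifferential.D k F x ∈ P.differentials ↔
      P.val (a * aeval x (g p ρ l μ)) ≤ 1 := by
  rcases eq_or_ne a 0 with rfl | ha0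
  · simp
  obtain ⟨e, he⟩ := P.exists_val_eq_zpow (H.sub_ne_zero _) h ha ha0
  have hξ := P.val_ne_zero (H.sub_ne_zero (ρ i))
  rw [H.smul_D_mem_differentials_of_eq h, H.val_mul_pow_of_eq h he, ← zpow_natCast,
    ← zpow_add₀ hξ, H.val_zpow_le_one_iff h, map_mul, he, H.val_g_of_eq h, ← zpow_add₀ hξ,
    H.val_zpow_le_one_iff h]
  have hm := le_m_iff hμ (l i) (e := -e)
  push_cast [Nat.cast_sub H.prime.one_le]
  constructor <;> intro hle
  · linarith [hm.2 (by linarith)]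
  · linarith [hm.1 (by linarith)]

theorem mul_pow_mem (H : IsCover p ρ l f x y) (h : P.val (x - algebraMap k F c) < 1) {a : F}
    (ha : a ∈ IntermediateField.adjoin k {x}) {μ : ℕ} (hμ : μ < p)
    (hreg : P.val (a / aeval x (g p ρ l (p - 1 - μ))) ≤ 1) : a * y ^ μ ∈ P.localRing := by
  by_cases hc : ∀ i, ρ i ≠ c
  · rw [map_div₀, val_g_of_ne P h hc, div_one, P.val_le_one_iff] at hreg
    exact mul_mem hreg (pow_mem (H.y_mem_of_ne h hc) μ)
  · push Not at hc
    obtain ⟨i, rfl⟩ := hc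
    exact (H.mul_pow_mem_iff_of_eq h ha hμ).2 hreg

theorem mul_pow_smul_D_mem [IsAlgClosed k] [CharP k p] (H : IsCover p ρ l f x y)
    (h : P.val (x - algebraMap k F c) < 1) {a : F}
    (ha : a ∈ IntermediateField.adjoin k {x}) {μ : ℕ} (hμ : μ < p)
    (hreg : P.val (a * aeval x (g p ρ l μ)) ≤ 1) :
    (a * y ^ μ) • KaehlerDifferential.D k F x ∈ P.differentials := by
  by_cases hc : ∀ i, ρ i ≠ c
  · rw [map_mul, val_g_of_ne P h hc, mul_one, P.val_le_one_iff] at hreg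
    rw [H.smul_D_mem_differentials_of_ne h hc, P.val_le_one_iff]
    exact mul_mem hreg (pow_mem (H.y_mem_of_ne h hc) μ)
  · push Not at hc
    obtain ⟨i, rfl⟩ := hc
    exact (H.mul_pow_smul_D_mem_iff_of_eq h ha hμ).2 hreg

theorem mul_pow_smul_D_mem_of_one_lt [IsAlgClosed k] [CharP k p] (H : IsCover p ρ l f x y)
    (h : 1 < P.val x) {a : F} (hreg : P.val (a * x ^ 2) ≤ 1) (μ : ℕ) :
    (a * y ^ μ) • KaehlerDifferential.D k F x ∈ P.differentials := by
  rw [H.smul_D_mem_differentials_of_one_lt h, mul_right_comm, P.val_le_one_iff]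
  exact mul_mem (P.val_le_one_iff.1 hreg) (pow_mem (H.y_mem_of_one_lt h) μ)

theorem val_coeff_div_le [CharP k p] (H : IsCover p ρ l f x y) {a : ℕ → F}
    (ha : ∀ μ, a μ ∈ IntermediateField.adjoin k {x})
    (hreg : ∀ P' : CurvePoint k F, P'.val (x - algebraMap k F c) < 1 →
      ∑ μ ∈ Finset.range p, a μ * y ^ μ ∈ P'.localRing)
    (h : P.val (x - algebraMap k F c) < 1) {μ : ℕ} (hμ : μ < p) :
    P.val (a μ / aeval x (g p ρ l (p - 1 - μ))) ≤ 1 := by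
  by_cases hc : ∀ i, ρ i ≠ c
  · rw [map_div₀, val_g_of_ne P h hc, div_one]
    exact H.val_coeff_le_of_ne h hc ha hreg hμ
  · push Not at hc
    obtain ⟨i, rfl⟩ := hc
    rw [← H.mul_pow_mem_iff_of_eq h (ha μ) hμ, ← P.val_le_one_iff]
    exact (H.val_le_val_sum h ha hμ).trans (P.val_le_one_iff.2 (hreg P h))

theorem val_coeff_mul_le [IsAlgClosed k] [CharP k p] (H : IsCover p ρ l f x y) {a : ℕ → F}
    (ha : ∀ μ, a μ ∈ IntermediateField.adjoin k {x})
    (hreg : ∀ P' : CurvePoint k F, P'.val (x - algebraMap k F c) < 1 →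
      (∑ μ ∈ Finset.range p, a μ * y ^ μ) • KaehlerDifferential.D k F x ∈ P'.differentials)
    (h : P.val (x - algebraMap k F c) < 1) {μ : ℕ} (hμ : μ < p) :
    P.val (a μ * aeval x (g p ρ l μ)) ≤ 1 := by
  by_cases hc : ∀ i, ρ i ≠ c
  · rw [map_mul, val_g_of_ne P h hc, mul_one]
    exact H.val_coeff_le_of_ne h hc ha (fun P' h' => P'.val_le_one_iff.1
      ((H.smul_D_mem_differentials_of_ne h' hc).1 (hreg P' h'))) hμ
  · push Not at hc
    obtain ⟨i, rfl⟩ := hc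
    rw [← H.mul_pow_smul_D_mem_iff_of_eq h (ha μ) hμ, H.smul_D_mem_differentials_of_eq h]
    refine (mul_le_mul_left (pow_le_pow_left₀ zero_le (H.val_le_val_sum h ha hμ) p) _).trans ?_
    exact (H.smul_D_mem_differentials_of_eq h).1 (hreg P h)

theorem val_coeff_mul_sq_le_of_one_lt [IsAlgClosed k] [CharP k p] (H : IsCover p ρ l f x y)
    {a : ℕ → F} (ha : ∀ μ, a μ ∈ IntermediateField.adjoin k {x})
    (hreg : ∀ P' : CurvePoint k F, 1 < P'.val x →
      (∑ μ ∈ Finset.range p, a μ * y ^ μ) • KaehlerDifferential.D k F x ∈ P'.differentials)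
    (h : 1 < P.val x) {μ : ℕ} (hμ : μ < p) : P.val (a μ * x ^ 2) ≤ 1 := by
  refine H.val_coeff_le_of_one_lt h (a := fun μ => a μ * x ^ 2) (fun μ => mul_mem (ha μ)
    (pow_mem (IntermediateField.mem_adjoin_simple_self k x) 2)) (fun P' h' => ?_) hμ
  simp only [mul_right_comm _ (x ^ 2), ← Finset.sum_mul]
  exact P'.val_le_one_iff.1 ((H.smul_D_mem_differentials_of_one_lt h').1 (hreg P' h'))

end IsCover

end ArtinSchreier

section LaurentPolynomials

variable {k F : Type*} [Field k] [Field F] [Algebra k F] {x s : F}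

theorem dvd_of_rootMultiplicity_le [IsAlgClosed k] {a d : k[X]} (hd : d ≠ 0)
    (h : ∀ c, d.rootMultiplicity c ≤ a.rootMultiplicity c) : d ∣ a := by
  classical
  refine (IsAlgClosed.splits d).dvd_of_roots_le_roots hd (Multiset.le_iff_count.2 fun c => ?_)
  simpa only [count_roots] using h c

theorem exists_eq_aeval_div_pow [IsAlgClosed k] (hx : Transcendental k x)
    (hs : s ∈ IntermediateField.adjoin k {x})
    (h : ∀ P : CurvePoint k F, P.val x = 1 → P.val s ≤ 1) :
    ∃ (q : k[X]) (n : ℕ), s = aeval x q / x ^ n := by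
  obtain ⟨a, d, rfl⟩ := (IntermediateField.mem_adjoin_simple_iff k s).1 hs
  rcases eq_or_ne a 0 with rfl | ha
  · exact ⟨0, 0, by simp⟩
  rcases eq_or_ne d 0 with rfl | hd
  · exact ⟨0, 0, by simp⟩
  obtain ⟨d', hd', hX⟩ := exists_eq_pow_rootMultiplicity_mul_and_not_dvd d hd 0
  have hd'0 : d' ≠ 0 := by rintro rfl; simp at hX
  have hdvd : d' ∣ a := dvd_of_rootMultiplicity_le hd'0 fun c => by
    rcases eq_or_ne c 0 with rfl | hc
    · rw [rootMultiplicity_eq_zero (by rwa [dvd_iff_isRoot] at hX)]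
      exact Nat.zero_le _
    · obtain ⟨P, hP⟩ := CurvePoint.exists_val_lt_one (transcendental_sub_algebraMap hx c)
      have hpos := P.val_pos (sub_algebraMap_ne_zero hx c)
      have hle := h P (P.val_eq_one_of_val_sub_lt hc hP)
      rw [map_div₀, P.val_aeval_eq_pow hP ha, P.val_aeval_eq_pow hP hd,
        div_le_one₀ (pow_pos hpos _), pow_le_pow_iff_right_of_lt_one₀ hpos hP] at hle
      exact (rootMultiplicity_le_rootMultiplicity_of_dvd hd (Dvd.intro_left _ hd'.symm) c).trans hle
  obtain ⟨q, rfl⟩ := hdvd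
  refine ⟨q, d.rootMultiplicity 0, ?_⟩
  have hdx : aeval x d = aeval x d' * x ^ d.rootMultiplicity 0 := by
    simpa [mul_comm] using congrArg (aeval x) hd'
  rw [hdx, map_mul, mul_div_mul_left _ _ (aeval_ne_zero_of_transcendental hx hd'0)]

theorem val_zpow_le_val_sum {P : CurvePoint k F} (hx : x ≠ 0) (hP : P.val x ≠ 1) {ι : Type*}
    {t : Finset ι} {e : ι → ℤ} (he : Function.Injective e) {c : ι → k} {i : ι} (hi : i ∈ t)
    (hc : c i ≠ 0) : P.val x ^ e i ≤ P.val (∑ j ∈ t, c j • x ^ e j) := by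
  have hval {j : ι} (hj : c j ≠ 0) : P.val (c j • x ^ e j) = P.val x ^ e j := by
    rw [Algebra.smul_def, map_mul, P.val_algebraMap hj, one_mul, map_zpow₀]
  have hne {j : ι} (hj : P.val (c j • x ^ e j) ≠ 0) : c j ≠ 0 := by
    rintro h0
    simp [h0] at hj
  rw [← hval hc]
  refine valuation_le_valuation_sum_of_pairwise_ne P.val (a := fun j => c j • x ^ e j) ?_ hi
  intro j _ j' _ hjj' hj hj' heq
  rw [hval (hne hj), hval (hne hj')] at heq
  exact hjj' (he (zpow_right_injective₀ (P.val_pos hx) hP heq))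

theorem smul_mem_span_zpow_smul [IsAlgClosed k] {M : Type*} [AddCommGroup M] [Module k M]
    [Module F M] [IsScalarTower k F M] (hx : Transcendental k x)
    (hs : s ∈ IntermediateField.adjoin k {x})
    (h : ∀ P : CurvePoint k F, P.val x = 1 → P.val s ≤ 1) (w : M) :
    s • w ∈ Submodule.span k ((fun j : ℤ => x ^ j • w) ''
      {j | ∀ P : CurvePoint k F, P.val x ≠ 1 → P.val x ^ j ≤ P.val s}) := by
  have hx0 := ne_zero_of_transcendental hx
  obtain ⟨q, n, rfl⟩ := exists_eq_aeval_div_pow hx hs h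
  have hsum : aeval x q / x ^ n =
      ∑ i ∈ Finset.range (q.natDegree + 1), q.coeff i • x ^ ((i : ℤ) - n) := by
    rw [aeval_eq_sum_range, Finset.sum_div]
    refine Finset.sum_congr rfl fun i _ => ?_
    rw [zpow_sub₀ hx0, zpow_natCast, zpow_natCast, smul_div_assoc]
  rw [hsum, Finset.sum_smul]
  refine Submodule.sum_mem _ fun i hi => ?_
  by_cases hqi : q.coeff i = 0
  · simp [hqi]
  rw [smul_assoc]
  refine Submodule.smul_mem _ _ (Submodule.subset_span ⟨i - n, fun P hP => ?_, rfl⟩)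
  exact val_zpow_le_val_sum hx0 hP (e := fun i : ℕ => (i : ℤ) - n) (fun _ _ => by simp) hi hqi

theorem nonneg_of_val_zpow_le_one (hx : Transcendental k x) {j : ℤ}
    (h : ∀ P : CurvePoint k F, P.val x < 1 → P.val x ^ j ≤ 1) : 0 ≤ j := by
  obtain ⟨P, hP⟩ := CurvePoint.exists_val_lt_one hx
  have hj := h P hP
  rwa [zpow_le_one_iff_right_of_lt_one₀ (P.val_pos (ne_zero_of_transcendental hx)) hP] at hj

theorem le_of_val_zpow_le (hx : Transcendental k x) {j n : ℤ}
    (h : ∀ P : CurvePoint k F, 1 < P.val x → P.val x ^ j ≤ P.val x ^ n) : j ≤ n := by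
  obtain ⟨P, hP⟩ := CurvePoint.exists_val_lt_one (transcendental_inv hx)
  rw [map_inv₀, inv_lt_one₀ (P.val_pos (ne_zero_of_transcendental hx))] at hP
  exact (zpow_le_zpow_iff_right₀ hP).1 (h P hP)

theorem linearIndependent_zpow {P : CurvePoint k F} (hx : x ≠ 0) (hP : P.val x ≠ 1) :
    LinearIndependent k fun j : ℤ => x ^ j := by
  rw [linearIndependent_iff']
  intro t c hsum j hj
  by_contra hc
  have hle := val_zpow_le_val_sum hx hP (e := id) Function.injective_id hj hc
  simp only [id, hsum, map_zero, le_zero_iff] at hle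
  exact zpow_ne_zero _ (P.val_ne_zero hx) hle

end LaurentPolynomials

namespace ArtinSchreier

/-- The functions `x ^ j g_{p-1-μ}(x) y ^ μ`, for `j : ℤ` and `μ < p`: they form a basis of
`𝒪_X(U_0 ∩ U_∞)` which is adapted to the subspaces `𝒪_X(U_0)` and `𝒪_X(U_∞)`. -/
noncomputable def basicFun {k F : Type*} [Field k] [Field F] [Algebra k F] {r : ℕ} (p : ℕ)
    (ρ : Fin r → k) (l : Fin r → ℕ) (x y : F) (i : ℤ × Fin p) : F :=
  x ^ i.1 * aeval x (g p ρ l (p - 1 - i.2)) * y ^ (i.2 : ℕ)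

namespace IsCover

variable {k F : Type*} [Field k] [Field F] [Algebra k F] {r p : ℕ} {ρ : Fin r → k}
  {l : Fin r → ℕ} {f : k[X]} {x y : F} {P : CurvePoint k F} {c : k}

theorem linearIndependent_zpow_mul (H : IsCover p ρ l f x y) {a : Fin p → F}
    (ha : ∀ μ, a μ ∈ IntermediateField.adjoin k {x}) (ha0 : ∀ μ, a μ ≠ 0) :
    LinearIndependent k fun i : ℤ × Fin p => x ^ i.1 * a i.2 * y ^ (i.2 : ℕ) := by
  let b : ℤ → IntermediateField.adjoin k {x} := fun j =>
    ⟨x ^ j, zpow_mem (IntermediateField.mem_adjoin_simple_self k x) j⟩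
  obtain ⟨P, hP⟩ := H.exists_point_infty
  have hb : LinearIndependent k b := LinearIndependent.of_comp
    (IntermediateField.adjoin k {x}).val.toLinearMap (linearIndependent_zpow H.ne_zero hP.ne')
  have h := linearIndependent_smul hb (H.isGenerator.linearIndependent_mul_pow ha ha0)
  have hsmul (i : ℤ × Fin p) :
      b i.1 • (a i.2 * y ^ (i.2 : ℕ)) = x ^ i.1 * a i.2 * y ^ (i.2 : ℕ) := (mul_assoc _ _ _).symm
  simpa only [hsmul] using h

theorem linearIndependent_basicFun (H : IsCover p ρ l f x y) :
    LinearIndependent k (basicFun p ρ l x y) :=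
  H.linearIndependent_zpow_mul (a := fun μ => aeval x (g p ρ l (p - 1 - μ)))
    (fun _ => aeval_mem_adjoin_simple x _) fun _ => H.aeval_g_ne_zero _

theorem basicFun_mem (H : IsCover p ρ l f x y) (h : P.val (x - algebraMap k F c) < 1)
    {i : ℤ × Fin p} (hi : P.val x ^ i.1 ≤ 1) : basicFun p ρ l x y i ∈ P.localRing := by
  refine H.mul_pow_mem h (mul_mem (zpow_mem (IntermediateField.mem_adjoin_simple_self k x) _)
    (aeval_mem_adjoin_simple x _)) i.2.2 ?_
  rwa [mul_div_cancel_right₀ _ (H.aeval_g_ne_zero _), map_zpow₀]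

theorem basicFun_mem_of_one_lt (H : IsCover p ρ l f x y) (h : 1 < P.val x)
    {i : ℤ × Fin p} (hi : i.1 ≤ -t p l (p - 1 - i.2)) : basicFun p ρ l x y i ∈ P.localRing := by
  refine mul_mem (P.val_le_one_iff.1 ?_) (pow_mem (H.y_mem_of_one_lt h) _)
  rw [map_mul, map_zpow₀, val_g_of_one_lt P h, ← zpow_natCast,
    ← zpow_add₀ (P.val_ne_zero H.ne_zero)]
  exact zpow_le_one_of_nonpos₀ h.le (by linarith)

section Regularity

variable [IsAlgClosed k]

theorem exists_center (H : IsCover p ρ l f x y) (h : P.val x ≤ 1) :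
    ∃ c : k, P.val (x - algebraMap k F c) < 1 :=
  H.isGenerator.exists_center (P.val_le_one_iff.1 h)

theorem basicFun_mem_inter (H : IsCover p ρ l f x y) (i : ℤ × Fin p) :
    basicFun p ρ l x y i ∈ regularFunctions (openZero k x ∩ openInfty k x) := fun P hP => by
  have hx : P.val x = 1 := le_antisymm (P.mem_openInfty_iff.1 hP.2) (P.mem_openZero_iff.1 hP.1)
  obtain ⟨c, hc⟩ := H.exists_center hx.le
  exact H.basicFun_mem hc (by simp [hx])

theorem basicFun_mem_openInfty (H : IsCover p ρ l f x y) {i : ℤ × Fin p} (hi : 0 ≤ i.1) :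
    basicFun p ρ l x y i ∈ regularFunctions (openInfty k x) := fun P hP => by
  have hx := P.mem_openInfty_iff.1 hP
  obtain ⟨c, hc⟩ := H.exists_center hx
  exact H.basicFun_mem hc (zpow_le_one₀ (P.val_pos H.ne_zero) hx hi)

theorem basicFun_mem_openZero (H : IsCover p ρ l f x y) {i : ℤ × Fin p}
    (hi : i.1 ≤ -t p l (p - 1 - i.2)) :
    basicFun p ρ l x y i ∈ regularFunctions (openZero k x) := fun P hP => by
  rcases (P.mem_openZero_iff.1 hP).eq_or_lt with hx | hx
  · obtain ⟨c, hc⟩ := H.exists_center hx.ge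
    exact H.basicFun_mem hc (by simp [← hx])
  · exact H.basicFun_mem_of_one_lt hx hi

theorem mem_span_basicFun [CharP k p] (H : IsCover p ρ l f x y) {h : F}
    (hh : h ∈ regularFunctions (openZero k x ∩ openInfty k x)) :
    h ∈ Submodule.span k (basicFun p ρ l x y '' {i |
      (h ∈ regularFunctions (openInfty k x) → 0 ≤ i.1) ∧
      (h ∈ regularFunctions (openZero k x) → i.1 ≤ -t p l (p - 1 - i.2))}) := by
  obtain ⟨a, ha, rfl⟩ := H.isGenerator.exists_eq_sum h
  refine Submodule.sum_mem _ fun μ hμ => ?_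
  rw [Finset.mem_range] at hμ
  have hlaurent := smul_mem_span_zpow_smul H.transcendental
    (s := a μ / aeval x (g p ρ l (p - 1 - μ)))
    (div_mem (ha μ) (aeval_mem_adjoin_simple x _)) (fun P hP => ?_)
    (aeval x (g p ρ l (p - 1 - μ)) * y ^ μ)
  · rw [smul_eq_mul, ← mul_assoc, div_mul_cancel₀ _ (H.aeval_g_ne_zero _)] at hlaurent
    refine Submodule.span_mono ?_ hlaurent
    rintro _ ⟨j, hj, rfl⟩
    refine ⟨(j, ⟨μ, hμ⟩), ⟨fun hreg => ?_, fun hreg => ?_⟩, mul_assoc _ _ _⟩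
    · refine nonneg_of_val_zpow_le_one H.transcendental fun P hP => (hj P hP.ne).trans ?_
      exact H.val_coeff_div_le (c := 0) ha (fun P' h' => hreg P'
        (P'.mem_openInfty_iff.2 (P'.val_le_one_of_val_sub_lt h'))) (by simpa using hP) hμ
    · refine le_of_val_zpow_le H.transcendental fun P hP => (hj P hP.ne').trans ?_
      rw [map_div₀, val_g_of_one_lt P hP, zpow_neg, zpow_natCast, div_eq_mul_inv]
      exact mul_le_of_le_one_left' (H.val_coeff_le_of_one_lt hP ha
        (fun P' h' => hreg P' (P'.mem_openZero_iff.2 h'.le)) hμ)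
  · obtain ⟨c, hc⟩ := H.exists_center hP.le
    have hc0 : c ≠ 0 := by
      rintro rfl
      exact (by simpa using hc : P.val x < 1).ne hP
    refine H.val_coeff_div_le ha (fun P' h' => hh P' ?_) hc hμ
    have hP' := P'.val_eq_one_of_val_sub_lt hc0 h'
    exact ⟨P'.mem_openZero_iff.2 hP'.ge, P'.mem_openInfty_iff.2 hP'.le⟩

theorem regularFunctions_inter_le [CharP k p] (H : IsCover p ρ l f x y) :
    regularFunctions (openZero k x ∩ openInfty k x) ≤
      Submodule.span k (Set.range (basicFun p ρ l x y)) := fun _ hh =>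
  Submodule.span_mono (Set.image_subset_range _ _) (H.mem_span_basicFun hh)

theorem regularFunctions_openInfty_eq [CharP k p] (H : IsCover p ρ l f x y) :
    regularFunctions (openInfty k x) =
      Submodule.span k (basicFun p ρ l x y '' {i | 0 ≤ i.1}) := by
  refine le_antisymm (fun h hh => ?_) (Submodule.span_le.2 ?_)
  · exact Submodule.span_mono (Set.image_mono fun i hi => hi.1 hh)
      (H.mem_span_basicFun fun P hP => hh P hP.2)
  · rintro _ ⟨i, hi, rfl⟩
    exact H.basicFun_mem_openInfty hi

theorem regularFunctions_openZero_eq [CharP k p] (H : IsCover p ρ l f x y) :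
    regularFunctions (openZero k x) =
      Submodule.span k (basicFun p ρ l x y '' {i | i.1 ≤ -t p l (p - 1 - i.2)}) := by
  refine le_antisymm (fun h hh => ?_) (Submodule.span_le.2 ?_)
  · exact Submodule.span_mono (Set.image_mono fun i hi => hi.2 hh)
      (H.mem_span_basicFun fun P hP => hh P hP.1)
  · rintro _ ⟨i, hi, rfl⟩
    exact H.basicFun_mem_openZero hi

theorem D_eq_zero_of_mem_openZero_of_mem_openInfty [CharP k p] (H : IsCover p ρ l f x y) {h : F}
    (h₀ : h ∈ regularFunctions (openZero k x)) (h₁ : h ∈ regularFunctions (openInfty k x)) :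
    KaehlerDifferential.D k F h = 0 := by
  suffices hle : Submodule.span k (basicFun p ρ l x y '' {i |
      (h ∈ regularFunctions (openInfty k x) → 0 ≤ i.1) ∧
      (h ∈ regularFunctions (openZero k x) → i.1 ≤ -t p l (p - 1 - i.2))}) ≤
      (KaehlerDifferential.D k F).toLinearMap.ker from
    hle (H.mem_span_basicFun fun P hP => h₀ P hP.1)
  rw [Submodule.span_le]
  rintro _ ⟨⟨j, μ, hμ⟩, ⟨hj, hj'⟩, rfl⟩
  specialize hj h₁
  specialize hj' h₀
  have hμ0 : μ = 0 := by
    by_contra hμ0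
    have := H.one_le_t (show p - 1 - μ + 1 < p by omega)
    simp only at hj hj'
    omega
  subst hμ0
  simp only at hj hj'
  obtain rfl : j = 0 := by omega
  simp [basicFun, g_pred H.prime.pos]

theorem omegaHol_mem [CharP k p] (H : IsCover p ρ l f x y)
    (h : P.val (x - algebraMap k F c) < 1) {μ : ℕ} (hμ : μ < p) (ν : ℕ) :
    omegaHol p ρ l x y μ ν ∈ P.differentials := by
  have hx := pow_mem (P.val_le_one_iff.1 (P.val_le_one_of_val_sub_lt h)) (ν - 1)
  rw [omegaHol, mul_div_left_comm, mul_comm]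
  refine H.mul_pow_smul_D_mem h (div_mem (pow_mem (IntermediateField.mem_adjoin_simple_self k x) _)
    (aeval_mem_adjoin_simple x _)) hμ ?_
  rwa [div_mul_cancel₀ _ (H.aeval_g_ne_zero μ), P.val_le_one_iff]

theorem omegaHol_mem_of_one_lt [CharP k p] (H : IsCover p ρ l f x y) (h : 1 < P.val x)
    {μ ν : ℕ} (hν : ν - 1 + 2 ≤ t p l μ) : omegaHol p ρ l x y μ ν ∈ P.differentials := by
  rw [omegaHol, mul_div_left_comm, mul_comm]
  refine H.mul_pow_smul_D_mem_of_one_lt h ?_ μ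
  rw [div_mul_eq_mul_div, ← pow_add, map_div₀, val_g_of_one_lt P h, map_pow]
  exact div_le_one_of_le₀ (pow_le_pow_right₀ h.le hν) zero_le

theorem regularDifferentials_inf_le [CharP k p] (H : IsCover p ρ l f x y) :
    regularDifferentials (openZero k x) ⊓ regularDifferentials (openInfty k x) ≤
      Submodule.span k (Set.range fun q : DeltaIndex p l => omegaHol p ρ l x y q.1.1 q.1.2) := by
  rintro ω ⟨h₀, h₁⟩
  obtain ⟨z, rfl⟩ := H.isGenerator.exists_eq_smul_D H.transcendental ω
  obtain ⟨a, ha, rfl⟩ := H.isGenerator.exists_eq_sum z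
  have hfin {c : k} {P : CurvePoint k F} (hP : P.val (x - algebraMap k F c) < 1) {μ : ℕ}
      (hμ : μ < p) : P.val (a μ * aeval x (g p ρ l μ)) ≤ 1 :=
    H.val_coeff_mul_le ha (fun P' h' =>
      h₁ P' (P'.mem_openInfty_iff.2 (P'.val_le_one_of_val_sub_lt h'))) hP hμ
  rw [Finset.sum_smul]
  refine Submodule.sum_mem _ fun μ hμ => ?_
  rw [Finset.mem_range] at hμ
  have hlaurent := smul_mem_span_zpow_smul H.transcendental (s := a μ * aeval x (g p ρ l μ))
    (mul_mem (ha μ) (aeval_mem_adjoin_simple x _))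
    (fun P hP => (H.exists_center hP.le).elim fun c hc => hfin hc hμ)
    ((y ^ μ / aeval x (g p ρ l μ)) • KaehlerDifferential.D k F x)
  rw [smul_smul, mul_assoc, mul_div_cancel₀ _ (H.aeval_g_ne_zero _)] at hlaurent
  refine Submodule.span_mono ?_ hlaurent
  rintro _ ⟨j, hj, rfl⟩
  have hj0 : 0 ≤ j := nonneg_of_val_zpow_le_one H.transcendental fun P hP =>
    (hj P hP.ne).trans (hfin (c := 0) (by simpa using hP) hμ)
  have hjt : j ≤ t p l μ - 2 := by
    refine le_of_val_zpow_le H.transcendental fun P hP => (hj P hP.ne').trans ?_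
    have hle := H.val_coeff_mul_sq_le_of_one_lt ha
      (fun P' h' => h₀ P' (P'.mem_openZero_iff.2 h'.le)) hP hμ
    have hx2 : 0 < P.val x ^ 2 := pow_pos (P.val_pos H.ne_zero) 2
    rw [map_mul, map_pow, ← le_inv_mul_iff₀' hx2, mul_one] at hle
    rw [map_mul, val_g_of_one_lt P hP, zpow_sub₀ (P.val_ne_zero H.ne_zero), zpow_natCast,
      div_eq_inv_mul]
    exact mul_le_mul_left hle _
  lift j to ℕ using hj0
  refine ⟨⟨(μ, j + 1), ?_⟩, ?_⟩
  · dsimp only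
    omega
  · simp [omegaHol, smul_smul]

end Regularity

theorem linearIndependent_omegaHol [CharP k p] (H : IsCover p ρ l f x y) :
    LinearIndependent k fun q : DeltaIndex p l => omegaHol p ρ l x y q.1.1 q.1.2 := by
  have hmul := H.linearIndependent_zpow_mul (a := fun μ => (aeval x (g p ρ l μ))⁻¹)
    (fun _ => inv_mem (aeval_mem_adjoin_simple x _)) fun _ => inv_ne_zero (H.aeval_g_ne_zero _)
  have hlt (q : DeltaIndex p l) : q.1.1 < p := by
    have := q.2.1
    have := H.prime.pos
    omega
  have hinj : Function.Injective fun q : DeltaIndex p l =>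
      (((q.1.2 : ℤ) - 1, ⟨q.1.1, hlt q⟩) : ℤ × Fin p) := by
    rintro ⟨⟨μ, ν⟩, _⟩ ⟨⟨μ', ν'⟩, _⟩ h
    exact Subtype.ext (by simpa [Prod.ext_iff, and_comm] using h)
  have hsmul (q : DeltaIndex p l) : omegaHol p ρ l x y q.1.1 q.1.2 =
      (x ^ ((q.1.2 : ℤ) - 1) * (aeval x (g p ρ l q.1.1))⁻¹ * y ^ q.1.1) •
        KaehlerDifferential.D k F x := by
    rw [omegaHol, ← zpow_natCast, Nat.cast_sub q.2.2.2.1, Nat.cast_one, div_eq_inv_mul, mul_assoc]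
  simp only [hsmul]
  exact (hmul.comp _ hinj).map' ((LinearMap.toSpanSingleton F _
    (KaehlerDifferential.D k F x)).restrictScalars k) (LinearMap.ker_eq_bot.2
      (smul_left_injective F (H.isGenerator.D_ne_zero H.transcendental)))

end IsCover

end ArtinSchreier

namespace ArtinSchreier

section Polynomials

variable {k : Type*} [Field k]

theorem lowPart_add_highPart (n : ℕ) (q : k[X]) : lowPart n q + highPart n q = q := by
  conv_rhs => rw [q.as_sum_support]
  rw [lowPart, highPart, ← Finset.sum_filter_add_sum_filter_not q.support (· < n)]
  simp only [not_lt]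

theorem coeff_lowPart (n : ℕ) (q : k[X]) (i : ℕ) :
    (lowPart n q).coeff i = if i < n then q.coeff i else 0 := by
  simp only [lowPart, finsetSum_coeff, coeff_monomial, Finset.sum_ite_eq', Finset.mem_filter,
    mem_support_iff]
  split_ifs <;> simp_all

theorem natDegree_lowPart_add_one_le (n : ℕ) (q : k[X]) : (lowPart (n + 1) q).natDegree ≤ n :=
  natDegree_le_iff_coeff_eq_zero.2 fun i hi => by rw [coeff_lowPart, if_neg (by omega)]

theorem X_pow_dvd_highPart (n : ℕ) (q : k[X]) : X ^ n ∣ highPart n q := by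
  refine Finset.dvd_sum fun i hi => ?_
  rw [← C_mul_X_pow_eq_monomial]
  exact (pow_dvd_pow X (Finset.mem_filter.1 hi).2).mul_left _

variable {r p μ ν : ℕ} {l : Fin r → ℕ}

theorem two_le_of_two_le_t (hp : 0 < p) (hμ : 1 ≤ μ) (ht : 2 ≤ t p l (p - μ)) : 2 ≤ μ := by
  refine lt_of_le_of_ne hμ ?_
  rintro rfl
  rw [t_pred hp] at ht
  omega

theorem coeff_phi_self (hp : 0 < p) (ρ : Fin r → k) (l : Fin r → ℕ) (ν : ℕ) :
    (phi p ρ l p ν).coeff ν = 0 := by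
  rw [phi, g_pred hp, mul_one, mul_one, coeff_sub, coeff_C_mul]
  cases ν with
  | zero => simp
  | succ n =>
    rw [coeff_X_mul, coeff_derivative]
    push_cast
    ring

theorem prod_X_sub_C_pow_dvd_g_mul_g (hl : ∀ i, (l i).Coprime p) (ρ : Fin r → k) (hμ : 2 ≤ μ)
    (hμp : μ ≤ p) :
    ∏ i, (X - C (ρ i)) ^ (l i + 1) ∣ g p ρ l (p - μ) * g p ρ l (μ - 2) := by
  rw [g, g, ← Finset.prod_mul_distrib]
  refine Finset.prod_dvd_prod_of_dvd _ _ fun i _ => ?_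
  rw [← pow_add]
  exact pow_dvd_pow _ (lt_m_add_m (hl i) hμ hμp)

end Polynomials

section BasicFunctions

variable {k F : Type*} [Field k] [Field F] [Algebra k F] {r p μ ν : ℕ} {l : Fin r → ℕ}

theorem hTilde_eq (ρ : Fin r → k) (l : Fin r → ℕ) (x y : F) (hμ : 1 ≤ μ) (hμp : μ ≤ p) (ν : ℕ) :
    hTilde p ρ l x y μ ν = basicFun p ρ l x y (-ν, ⟨μ - 1, by omega⟩) := by
  rw [hTilde, basicFun, zpow_neg, zpow_natCast, show p - 1 - (μ - 1) = p - μ by omega,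
    div_eq_inv_mul, mul_assoc]

end BasicFunctions

namespace IsCover

variable {k F : Type*} [Field k] [Field F] [Algebra k F] {r p : ℕ} {ρ : Fin r → k}
  {l : Fin r → ℕ} {f : k[X]} {x y : F} {P : CurvePoint k F} {c : k} {μ ν : ℕ}

theorem D_hTilde [CharP k p] (H : IsCover p ρ l f x y) (hμ : 1 ≤ μ) (hν : 1 ≤ ν) :
    KaehlerDifferential.D k F (hTilde p ρ l x y μ ν) =
      (aeval x (phi p ρ l μ ν) / x ^ (ν + 1)) • omegaHol p ρ l x y (μ - 1) 1
        + (aeval x (psi ρ l f) / x ^ ν) • omega p ρ l x y μ := by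
  have hx := H.ne_zero
  have hg := H.aeval_g_ne_zero (μ - 1)
  have hd := H.aeval_ne_zero (monic_prod_X_sub_C_pow ρ fun i => l i + 1).ne_zero
  rw [aeval_prod_X_sub_C_pow] at hd
  have hphi : aeval x (phi p ρ l μ ν) = x * aeval x (derivative (g p ρ l (p - μ))) *
      aeval x (g p ρ l (μ - 1)) - ν * aeval x (g p ρ l (p - μ)) * aeval x (g p ρ l (μ - 1)) := by
    simp [phi]
  rw [hTilde, Derivation.leibniz_div, Derivation.leibniz, Derivation.leibniz_pow,
    Derivation.leibniz_pow, H.D_y, Derivation.map_aeval, omegaHol, omega, hphi,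
    ← Nat.cast_smul_eq_nsmul F, ← Nat.cast_smul_eq_nsmul F]
  simp only [smul_smul, ← add_smul, ← sub_smul]
  congr 1
  obtain ⟨n, rfl⟩ := Nat.exists_eq_add_of_le' hν
  obtain ⟨a, rfl⟩ := Nat.exists_eq_add_of_le' hμ
  simp only [Nat.add_sub_cancel] at hg
  simp only [Nat.add_sub_cancel, Nat.sub_self, pow_zero, one_mul, Nat.cast_add, Nat.cast_one,
    add_sub_cancel_right, Nat.add_sub_add_right a 1 1]
  field_simp
  ring

theorem aeval_highPart_div_pow_mem (H : IsCover p ρ l f x y) (h : x ∈ P.localRing) (n : ℕ)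
    (q : k[X]) : aeval x (highPart n q) / x ^ n ∈ P.localRing := by
  obtain ⟨w, hw⟩ := X_pow_dvd_highPart n q
  rw [hw, map_mul, map_pow, aeval_X, mul_div_cancel_left₀ _ (pow_ne_zero _ H.ne_zero)]
  exact P.aeval_mem_localRing h w

theorem natDegree_lowPart_phi_le (H : IsCover p ρ l f x y) (hμ : 1 ≤ μ) (hμp : μ ≤ p)
    (hν : 1 ≤ ν) : (lowPart (ν + 1) (phi p ρ l μ ν)).natDegree ≤ ν - 1 + t p l (μ - 1) := by
  have hdeg := natDegree_lowPart_add_one_le ν (phi p ρ l μ ν)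
  rcases hμp.lt_or_eq with hlt | rfl
  · have := H.one_le_t (show μ - 1 + 1 < p by omega)
    omega
  · refine le_add_right (natDegree_le_pred hdeg ?_)
    rw [coeff_lowPart, if_pos ν.lt_add_one, coeff_phi_self hμ]

section Regularity

variable [IsAlgClosed k] [CharP k p]

theorem omega_mem (H : IsCover p ρ l f x y) (h : P.val (x - algebraMap k F c) < 1) (hμ : 2 ≤ μ)
    (hμp : μ ≤ p) : omega p ρ l x y μ ∈ P.differentials := by
  obtain ⟨w, hw⟩ := prod_X_sub_C_pow_dvd_g_mul_g H.coprime ρ hμ hμp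
  have hd := H.aeval_ne_zero (monic_prod_X_sub_C_pow ρ fun i => l i + 1).ne_zero
  have hcancel : ((μ : F) - 1) * aeval x (g p ρ l (p - μ)) /
      aeval x (∏ i, (X - C (ρ i)) ^ (l i + 1)) * aeval x (g p ρ l (μ - 2)) =
      ((μ : F) - 1) * aeval x w := by
    rw [div_mul_eq_mul_div, mul_assoc, ← map_mul, hw, map_mul, mul_left_comm,
      mul_div_cancel_left₀ _ hd]
  rw [omega, ← aeval_prod_X_sub_C_pow, mul_div_right_comm]
  refine H.mul_pow_smul_D_mem h (div_mem (mul_mem (sub_mem (natCast_mem _ μ) (one_mem _))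
    (aeval_mem_adjoin_simple x _)) (aeval_mem_adjoin_simple x _)) (by omega) ?_
  rw [hcancel, P.val_le_one_iff]
  exact mul_mem (sub_mem (natCast_mem _ μ) (one_mem _))
    (P.aeval_mem_localRing (P.val_le_one_iff.1 (P.val_le_one_of_val_sub_lt h)) w)

theorem smul_omega_mem_of_one_lt (H : IsCover p ρ l f x y) (h : 1 < P.val x) (hμ : 1 ≤ μ)
    (hμp : μ ≤ p) {z : F} (hz : P.val (z * x) ≤ 1) : z • omega p ρ l x y μ ∈ P.differentials := by
  have hgx : P.val (aeval x (g p ρ l (p - μ)) /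
      aeval x (∏ i, (X - C (ρ i)) ^ (l i + 1)) * x) ≤ 1 := by
    rw [map_mul, map_div₀, val_g_of_one_lt P h, val_aeval_prod_of_one_lt P h, div_mul_eq_mul_div,
      ← pow_succ]
    refine div_le_one_of_le₀ (pow_le_pow_right₀ h.le ?_) zero_le
    have := H.pos
    have := t_le (show p - μ < p by omega) l
    simp only [Finset.sum_add_distrib, Finset.sum_const, Finset.card_univ, Fintype.card_fin,
      smul_eq_mul, mul_one]
    omega
  have hsplit : z * (((μ : F) - 1) * aeval x (g p ρ l (p - μ)) * y ^ (μ - 2) /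
      aeval x (∏ i, (X - C (ρ i)) ^ (l i + 1))) = ((μ : F) - 1) * z * (aeval x (g p ρ l (p - μ)) /
      aeval x (∏ i, (X - C (ρ i)) ^ (l i + 1))) * y ^ (μ - 2) := by
    ring
  rw [omega, ← aeval_prod_X_sub_C_pow, smul_smul, hsplit]
  refine H.mul_pow_smul_D_mem_of_one_lt h ?_ _
  rw [P.val_le_one_iff] at hz hgx ⊢
  convert mul_mem (mul_mem (sub_mem (natCast_mem P.localRing μ) (one_mem _)) hz) hgx using 1
  ring

theorem smul_omegaHol_one_mem_of_one_lt (H : IsCover p ρ l f x y) (h : 1 < P.val x) {z : F}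
    (hz : P.val (z * x ^ 2) ≤ P.val x ^ t p l μ) :
    z • omegaHol p ρ l x y μ 1 ∈ P.differentials := by
  rw [omegaHol, Nat.sub_self, pow_zero, one_mul, smul_smul, mul_div_left_comm, mul_comm]
  refine H.mul_pow_smul_D_mem_of_one_lt h ?_ μ
  rw [div_mul_eq_mul_div, map_div₀, val_g_of_one_lt P h]
  exact div_le_one_of_le₀ hz zero_le

theorem deltaTriple_mem (H : IsCover p ρ l f x y) (q : DeltaIndex p l) :
    deltaTriple p ρ l x y q.1.1 q.1.2 ∈ deRhamCocycles k x := by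
  obtain ⟨⟨μ, ν⟩, hμ, ht, hν, hνt⟩ := q
  have hμp : μ < p := by
    have := H.prime.pos
    simp only at hμ
    omega
  refine ⟨fun P hP => ?_, fun P hP => ?_, zero_mem _, by simp [deltaTriple]⟩
  · rcases (P.mem_openZero_iff.1 hP).eq_or_lt with hx | hx
    · obtain ⟨c, hc⟩ := H.exists_center hx.ge
      exact H.omegaHol_mem hc hμp ν
    · refine H.omegaHol_mem_of_one_lt hx ?_
      simp only at ht hν hνt ⊢
      omega
  · obtain ⟨c, hc⟩ := H.exists_center (P.mem_openInfty_iff.1 hP)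
    exact H.omegaHol_mem hc hμp ν

theorem aTriple_fst_mem (H : IsCover p ρ l f x y) (hμ : 2 ≤ μ) (hμp : μ ≤ p) (hν : 1 ≤ ν) :
    (aTriple p ρ l f x y μ ν).1 ∈ regularDifferentials (openZero k x) := fun P hP => by
  rcases (P.mem_openZero_iff.1 hP).eq_or_lt with hx | hx
  · obtain ⟨c, hc⟩ := H.exists_center hx.ge
    have hcoeff (n : ℕ) (q : k[X]) : P.val (aeval x q / x ^ n) ≤ 1 := by
      rw [map_div₀, map_pow, ← hx, one_pow, div_one]
      exact P.val_aeval_le hx.ge q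
    exact add_mem (P.smul_mem_differentials (hcoeff _ _) (H.omegaHol_mem hc (by omega) 1))
      (P.smul_mem_differentials (hcoeff _ _) (H.omega_mem hc hμ hμp))
  · have hx0 := pow_pos (P.val_pos H.ne_zero) (ν - 1)
    refine add_mem (H.smul_omegaHol_one_mem_of_one_lt hx ?_)
      (H.smul_omega_mem_of_one_lt hx (by omega) hμp ?_)
    · have hshift : aeval x (lowPart (ν + 1) (phi p ρ l μ ν)) / x ^ (ν + 1) * x ^ 2 =
          aeval x (lowPart (ν + 1) (phi p ρ l μ ν)) / x ^ (ν - 1) := by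
        rw [show ν + 1 = ν - 1 + 2 by omega, pow_add, div_mul_eq_div_div,
          div_mul_cancel₀ _ (pow_ne_zero 2 H.ne_zero)]
      rw [hshift, map_div₀, map_pow, div_le_iff₀' hx0, ← pow_add]
      exact P.val_aeval_le_pow hx (H.natDegree_lowPart_phi_le (by omega) hμp hν)
    · obtain ⟨n, rfl⟩ := Nat.exists_eq_add_of_le' hν
      rw [pow_succ, div_mul_eq_div_div, div_mul_cancel₀ _ H.ne_zero, map_div₀, map_pow]
      exact div_le_one_of_le₀ (P.val_aeval_le_pow hx (natDegree_lowPart_add_one_le n _)) zero_le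

theorem aTriple_snd_mem (H : IsCover p ρ l f x y) (hμ : 2 ≤ μ) (hμp : μ ≤ p) (ν : ℕ) :
    (aTriple p ρ l f x y μ ν).2.1 ∈ regularDifferentials (openInfty k x) := fun P hP => by
  have hx := P.mem_openInfty_iff.1 hP
  obtain ⟨c, hc⟩ := H.exists_center hx
  have hcoeff (n : ℕ) (q : k[X]) : P.val (aeval x (highPart n q) / x ^ n) ≤ 1 :=
    P.val_le_one_iff.2 (H.aeval_highPart_div_pow_mem (P.val_le_one_iff.1 hx) n q)
  exact neg_mem (add_mem
    (P.smul_mem_differentials (hcoeff _ _) (H.omegaHol_mem hc (by omega) 1))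
    (P.smul_mem_differentials (hcoeff _ _) (H.omega_mem hc hμ hμp)))

theorem aTriple_mem (H : IsCover p ρ l f x y) (q : AIndex p l) :
    aTriple p ρ l f x y q.1.1 q.1.2 ∈ deRhamCocycles k x := by
  obtain ⟨⟨μ, ν⟩, hμ, hμp, ht, hν, -⟩ := q
  have hμ2 := two_le_of_two_le_t H.prime.pos hμ ht
  refine ⟨H.aTriple_fst_mem hμ2 hμp hν, H.aTriple_snd_mem hμ2 hμp ν, ?_, ?_⟩
  · rw [aTriple, hTilde_eq ρ l x y hμ hμp]
    exact H.basicFun_mem_inter _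
  · simp only [aTriple]
    rw [H.D_hTilde hμ hν, sub_neg_eq_add, add_add_add_comm, ← add_smul, ← add_smul, ← add_div,
      ← add_div, ← map_add, ← map_add, lowPart_add_highPart, lowPart_add_highPart]

end Regularity

end IsCover

end ArtinSchreier

section DeRhamCohomology

variable (k : Type*) {F : Type*} [Field k] [Field F] [Algebra k F] (x : F)

/-- The global differentials `H⁰(X, Ω)`: the differentials regular on `U_0` and on `U_∞`. -/
noncomputable def globalDifferentials : Submodule k Ω[F⁄k] :=
  regularDifferentials (openZero k x) ⊓ regularDifferentials (openInfty k x)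

/-- The map `H⁰(X, Ω) → H¹_dR(X/k)` of the Hodge filtration, `ω ↦ [(ω, ω, 0)]`. -/
noncomputable def ofGlobalDifferential : globalDifferentials k x →ₗ[k] DeRhamH1 k x :=
  Submodule.mkQ _ ∘ₗ LinearMap.codRestrict (deRhamCocycles k x)
    ((LinearMap.id.prod (LinearMap.id.prod 0)) ∘ₗ (globalDifferentials k x).subtype)
    fun ω => ⟨ω.2.1, ω.2.2, zero_mem _, by simp⟩

/-- The map `H¹_dR(X/k) → H¹(X, 𝒪)` of the Hodge filtration, `[(ω_0, ω_∞, h)] ↦ [h]`, where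
`H¹(X, 𝒪)` is computed by the covering `X = U_0 ∪ U_∞`. For simplicity the target is `F` instead of
`𝒪(U_0 ∩ U_∞)` modulo `𝒪(U_0) + 𝒪(U_∞)`. -/
noncomputable def toStructureSheafH1 : DeRhamH1 k x →ₗ[k]
    F ⧸ (regularFunctions (openZero k x) ⊔ regularFunctions (openInfty k x)) :=
  Submodule.liftQ _ (Submodule.mkQ _ ∘ₗ LinearMap.snd k Ω[F⁄k] F ∘ₗ LinearMap.snd k Ω[F⁄k] _ ∘ₗ
    (deRhamCocycles k x).subtype) (by
      rintro ⟨_, _⟩ ⟨h₀, hh₀, h₁, hh₁, rfl⟩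
      exact (Submodule.Quotient.mk_eq_zero _).2
        (sub_mem (Submodule.mem_sup_left hh₀) (Submodule.mem_sup_right hh₁)))

variable {k x}

theorem range_ofGlobalDifferential :
    (ofGlobalDifferential k x).range = (toStructureSheafH1 k x).ker := by
  apply le_antisymm
  · rintro _ ⟨ω, rfl⟩
    exact map_zero (Submodule.mkQ _)
  rintro v hv
  obtain ⟨⟨⟨ω₀, ω₁, h⟩, hc⟩, rfl⟩ := Submodule.mkQ_surjective _ v
  obtain ⟨h₀, hh₀, h₁, hh₁, rfl⟩ :=
    Submodule.mem_sup.1 ((Submodule.Quotient.mk_eq_zero _).1 (LinearMap.mem_ker.1 hv))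
  obtain ⟨hω₀, hω₁, -, hD⟩ := id hc
  have hb : (KaehlerDifferential.D k F h₀, KaehlerDifferential.D k F (-h₁), h₀ - -h₁) ∈
      deRhamCoboundaries k x := ⟨h₀, hh₀, -h₁, neg_mem hh₁, rfl⟩
  have hb' := deRhamCoboundaries_le x hb
  have hglue : ω₀ - KaehlerDifferential.D k F h₀ = ω₁ - KaehlerDifferential.D k F (-h₁) := by
    rw [sub_eq_sub_iff_sub_eq_sub, ← hD, ← map_sub, sub_neg_eq_add]
  refine ⟨⟨ω₀ - KaehlerDifferential.D k F h₀, sub_mem hω₀ hb'.1, hglue ▸ sub_mem hω₁ hb'.2.1⟩,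
    (Submodule.Quotient.eq _).2 ?_⟩
  refine ⟨-h₀, neg_mem hh₀, h₁, hh₁, Prod.ext ?_ (Prod.ext ?_ ?_)⟩
  · change ω₀ - _ - ω₀ = _
    rw [map_neg, sub_sub_cancel_left]
  · change ω₀ - _ - ω₁ = _
    rw [hglue, map_neg, sub_neg_eq_add, add_sub_cancel_left]
  · change 0 - (h₀ + h₁) = -h₀ - h₁
    ring

theorem ofGlobalDifferential_injective
    (hconst : ∀ h ∈ regularFunctions (openZero k x) ⊓ regularFunctions (openInfty k x),
      KaehlerDifferential.D k F h = 0) :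
    Function.Injective (ofGlobalDifferential k x) := by
  rw [injective_iff_map_eq_zero]
  intro ω hω
  obtain ⟨h₀, hh₀, h₁, hh₁, e⟩ := (Submodule.Quotient.mk_eq_zero _).1 hω
  obtain ⟨hω₀, -, h01⟩ : ω = KaehlerDifferential.D k F h₀ ∧
    ω = KaehlerDifferential.D k F h₁ ∧ 0 = h₀ - h₁ := by
    simp only [Prod.ext_iff] at e
    exact e
  obtain rfl := sub_eq_zero.1 h01.symm
  exact Subtype.ext (hω₀.trans (hconst h₀ ⟨hh₀, hh₁⟩))

end DeRhamCohomology

namespace ArtinSchreier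

section Indices

variable {r p : ℕ} {l : Fin r → ℕ}

/-- The index of the function `h̃_{μ,ν}` in the family `basicFun`. -/
def AIndex.toBasic (q : AIndex p l) : ℤ × Fin p :=
  (-q.1.2, ⟨q.1.1 - 1, by have := q.2.1; have := q.2.2.1; omega⟩)

theorem AIndex.toBasic_injective : Function.Injective (AIndex.toBasic : AIndex p l → _) := by
  rintro ⟨⟨μ, ν⟩, hμ, _⟩ ⟨⟨μ', ν'⟩, hμ', _⟩ h
  simp only [AIndex.toBasic, Prod.mk.injEq, Fin.mk.injEq] at h hμ hμ'
  refine Subtype.ext (Prod.ext ?_ ?_) <;> simp only <;> omega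

theorem AIndex.mem_range_toBasic {i : ℤ × Fin p} :
    i ∈ Set.range (AIndex.toBasic : AIndex p l → _) ↔
      i.1 < 0 ∧ -t p l (p - 1 - i.2) < i.1 := by
  obtain ⟨j, μ, hμ⟩ := i
  constructor
  · rintro ⟨⟨⟨μ', ν⟩, h₁, h₂, ht, hν, hνt⟩, h⟩
    simp only [AIndex.toBasic, Prod.mk.injEq, Fin.mk.injEq] at h h₁ h₂ ht hν hνt ⊢
    rw [show p - 1 - μ = p - μ' by omega]
    omega
  · simp only
    rintro ⟨hj, ht⟩
    rw [show p - 1 - μ = p - (μ + 1) by omega] at ht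
    refine ⟨⟨(μ + 1, (-j).toNat), by simp, hμ, ?_, ?_, ?_⟩, ?_⟩
    · dsimp only
      omega
    · dsimp only
      omega
    · dsimp only
      omega
    · simp only [AIndex.toBasic, Nat.add_sub_cancel, Prod.mk.injEq, and_true]
      omega

end Indices

namespace IsCover

variable {k F : Type*} [Field k] [IsAlgClosed k] [Field F] [Algebra k F] {r p : ℕ} [CharP k p]
  {ρ : Fin r → k} {l : Fin r → ℕ} {f : k[X]} {x y : F}

/-- The class `a_{μ,ν}`. -/
noncomputable def aClass (H : IsCover p ρ l f x y) (q : AIndex p l) : DeRhamH1 k x :=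
  deRhamClass x (aTriple p ρ l f x y q.1.1 q.1.2) (H.aTriple_mem q)

/-- The class `δ_{μ,ν}`. -/
noncomputable def deltaClass (H : IsCover p ρ l f x y) (q : DeltaIndex p l) : DeRhamH1 k x :=
  deRhamClass x (deltaTriple p ρ l x y q.1.1 q.1.2) (H.deltaTriple_mem q)

/-- The forms `ω_{μ,ν}` underlying the classes `δ_{μ,ν}`, as global differentials. -/
noncomputable def globalForm (H : IsCover p ρ l f x y) (q : DeltaIndex p l) :
    globalDifferentials k x :=
  ⟨omegaHol p ρ l x y q.1.1 q.1.2, (H.deltaTriple_mem q).1, (H.deltaTriple_mem q).2.1⟩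

theorem ofGlobalDifferential_comp_globalForm (H : IsCover p ρ l f x y) :
    ofGlobalDifferential k x ∘ H.globalForm = H.deltaClass := rfl

theorem linearIndependent_deltaClass (H : IsCover p ρ l f x y) :
    LinearIndependent k H.deltaClass := by
  have hform : LinearIndependent k H.globalForm :=
    .of_comp (globalDifferentials k x).subtype H.linearIndependent_omegaHol
  have hinj := ofGlobalDifferential_injective (k := k) (x := x) fun _ hh =>
    H.D_eq_zero_of_mem_openZero_of_mem_openInfty hh.1 hh.2
  rw [← ofGlobalDifferential_comp_globalForm]
  exact hform.map' (ofGlobalDifferential k x) (LinearMap.ker_eq_bot.2 hinj)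

theorem span_range_globalForm (H : IsCover p ρ l f x y) :
    Submodule.span k (Set.range H.globalForm) = ⊤ := by
  refine (Submodule.map_injective_of_injective (globalDifferentials k x).subtype_injective) ?_
  rw [Submodule.map_span, ← Set.range_comp, Submodule.map_top, Submodule.range_subtype]
  refine le_antisymm (Submodule.span_le.2 ?_) H.regularDifferentials_inf_le
  rintro _ ⟨q, rfl⟩
  exact (H.globalForm q).2

theorem span_range_deltaClass (H : IsCover p ρ l f x y) :
    Submodule.span k (Set.range H.deltaClass) = (toStructureSheafH1 k x).ker := by
  rw [← range_ofGlobalDifferential, LinearMap.range_eq_map, ← H.span_range_globalForm,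
    Submodule.map_span, ← Set.range_comp, ofGlobalDifferential_comp_globalForm]

theorem toStructureSheafH1_aClass (H : IsCover p ρ l f x y) (q : AIndex p l) :
    toStructureSheafH1 k x (H.aClass q) = Submodule.Quotient.mk (basicFun p ρ l x y q.toBasic) :=
  congrArg Submodule.Quotient.mk (hTilde_eq ρ l x y q.2.1 q.2.2.1 _)

theorem linearIndependent_toStructureSheafH1_aClass (H : IsCover p ρ l f x y) :
    LinearIndependent k (toStructureSheafH1 k x ∘ H.aClass) := by
  rw [funext H.toStructureSheafH1_aClass (f := toStructureSheafH1 k x ∘ H.aClass)]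
  refine (H.linearIndependent_basicFun.comp _ AIndex.toBasic_injective).map
    (f := Submodule.mkQ _) ?_
  rw [Submodule.ker_mkQ, Set.range_comp, H.regularFunctions_openZero_eq,
    H.regularFunctions_openInfty_eq, ← Submodule.span_union, ← Set.image_union]
  refine H.linearIndependent_basicFun.disjoint_span_image (Set.disjoint_left.2 fun i hi => ?_)
  rw [AIndex.mem_range_toBasic] at hi
  simp only [Set.mem_union, Set.mem_ofPred_eq, not_or, not_le]
  exact hi.symm

theorem map_toStructureSheafH1_span_aClass (H : IsCover p ρ l f x y) :
    (Submodule.span k (Set.range H.aClass)).map (toStructureSheafH1 k x) =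
      (toStructureSheafH1 k x).range := by
  refine le_antisymm LinearMap.map_le_range ?_
  rintro _ ⟨v, rfl⟩
  obtain ⟨z, rfl⟩ := Submodule.mkQ_surjective _ v
  suffices hle : Submodule.span k (Set.range (basicFun p ρ l x y)) ≤
      ((Submodule.span k (Set.range H.aClass)).map (toStructureSheafH1 k x)).comap
        (Submodule.mkQ _) from
    hle (H.regularFunctions_inter_le z.2.2.2.1)
  rw [Submodule.span_le]
  rintro _ ⟨i, rfl⟩
  by_cases hi : i ∈ Set.range (AIndex.toBasic : AIndex p l → _)
  · obtain ⟨q, rfl⟩ := hi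
    exact ⟨H.aClass q, Submodule.subset_span ⟨q, rfl⟩, H.toStructureSheafH1_aClass q⟩
  · suffices hmem : basicFun p ρ l x y i ∈
        regularFunctions (openZero k x) ⊔ regularFunctions (openInfty k x) by
      rw [SetLike.mem_coe, Submodule.mem_comap, Submodule.mkQ_apply,
        (Submodule.Quotient.mk_eq_zero _).2 hmem]
      exact zero_mem _
    rw [AIndex.mem_range_toBasic, not_and_or, not_lt, not_lt] at hi
    rcases hi with hi | hi
    · exact Submodule.mem_sup_right (H.basicFun_mem_openInfty hi)
    · exact Submodule.mem_sup_left (H.basicFun_mem_openZero hi)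

theorem linearIndependent_sum (H : IsCover p ρ l f x y) :
    LinearIndependent k (Sum.elim H.aClass H.deltaClass) := by
  have ha := H.linearIndependent_toStructureSheafH1_aClass
  refine LinearIndependent.sum_type (LinearIndependent.of_comp _ ha)
    H.linearIndependent_deltaClass ?_
  rw [span_range_deltaClass]
  exact Submodule.range_ker_disjoint ha

theorem top_le_span (H : IsCover p ρ l f x y) :
    ⊤ ≤ Submodule.span k (Set.range (Sum.elim H.aClass H.deltaClass)) := by
  rw [Set.Sum.elim_range, Submodule.span_union, H.span_range_deltaClass, ← Submodule.comap_map_eq,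
    H.map_toStructureSheafH1_span_aClass]
  exact fun v _ => ⟨v, rfl⟩

end IsCover

end ArtinSchreier

theorem mainTheorem2_general {k F : Type*} [Field k] [IsAlgClosed k] [Field F] [Algebra k F]
    {p : ℕ} [CharP k p] {r : ℕ} {ρ : Fin r → k} {l : Fin r → ℕ} {f : k[X]} {x y : F}
    (H : ArtinSchreier.IsCover p ρ l f x y) :
    ∃ (ha : ∀ q : ArtinSchreier.AIndex p l,
          ArtinSchreier.aTriple p ρ l f x y q.1.1 q.1.2 ∈ deRhamCocycles k x)
      (hδ : ∀ q : ArtinSchreier.DeltaIndex p l,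
          ArtinSchreier.deltaTriple p ρ l x y q.1.1 q.1.2 ∈ deRhamCocycles k x)
      (b : Module.Basis (ArtinSchreier.AIndex p l ⊕ ArtinSchreier.DeltaIndex p l) k
          (DeRhamH1 k x)),
      (∀ q : ArtinSchreier.AIndex p l,
        b (Sum.inl q) = deRhamClass x (ArtinSchreier.aTriple p ρ l f x y q.1.1 q.1.2) (ha q)) ∧
      (∀ q : ArtinSchreier.DeltaIndex p l,
        b (Sum.inr q) = deRhamClass x (ArtinSchreier.deltaTriple p ρ l x y q.1.1 q.1.2) (hδ q)) :=
  ⟨H.aTriple_mem, H.deltaTriple_mem, Module.Basis.mk H.linearIndependent_sum H.top_le_span,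
    fun _ => Module.Basis.mk_apply _ _ _, fun _ => Module.Basis.mk_apply _ _ _⟩

theorem mainTheorem2 {k F : Type*} [Field k] [IsAlgClosed k] [Field F] [Algebra k F]
    (p : ℕ) [CharP k p] (hp : p.Prime) (hp3 : 3 ≤ p)
    (r : ℕ) (hr : 1 ≤ r)
    (ρ : Fin r → k) (hρ : Function.Injective ρ)
    (l : Fin r → ℕ) (hl : ∀ i, 1 ≤ l i) (hlp : ∀ i, (l i).Coprime p)
    (f : Polynomial k)
    (hf : IsCoprime f (∏ i, (Polynomial.X - Polynomial.C (ρ i)) ^ l i))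
    (hf0 : ¬ Polynomial.X ∣ f)
    (hfdeg : f.natDegree = ∑ i, l i)
    (x y : F) (hx : Transcendental k x)
    (hF : IntermediateField.adjoin k {x, y} = ⊤)
    (hxy : y ^ p - y =
      Polynomial.aeval x f / ∏ i, (x - algebraMap k F (ρ i)) ^ l i) :
    ∃ (ha : ∀ q : ArtinSchreier.AIndex p l,
          ArtinSchreier.aTriple p ρ l f x y q.1.1 q.1.2 ∈ deRhamCocycles k x)
      (hδ : ∀ q : ArtinSchreier.DeltaIndex p l,
          ArtinSchreier.deltaTriple p ρ l x y q.1.1 q.1.2 ∈ deRhamCocycles k x)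
      (b : Module.Basis (ArtinSchreier.AIndex p l ⊕ ArtinSchreier.DeltaIndex p l) k
          (DeRhamH1 k x)),
      (∀ q : ArtinSchreier.AIndex p l,
        b (Sum.inl q) = deRhamClass x (ArtinSchreier.aTriple p ρ l f x y q.1.1 q.1.2) (ha q)) ∧
      (∀ q : ArtinSchreier.DeltaIndex p l,
        b (Sum.inr q) = deRhamClass x (ArtinSchreier.deltaTriple p ρ l x y q.1.1 q.1.2) (hδ q)) :=
  mainTheorem2_general ⟨hp, hr, hρ, hl, hlp, hf, hfdeg.le, hx, hF, hxy⟩
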